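/- Let $\mathbb K$ be a field of characteristic $0$. For $n\ge 0$ let $$\Omega_n=\bigoplus_{p}\Omega_n^p=\frac{\mathbb K[x_0,\dots,x_n,dx_0,\dots,dx_n]}{\left(\sum_i x_i-1,\ \sum_i dx_i\right)}$$ be the differential graded algebra of polynomial differential forms on the affine standard simplex $\Delta^n_{\mathbb K}=\{x\in\mathbb K^{n+1}: \sum_i x_i=1\}$, with vertices $e_0,\dots,e_n$. For $g\colon[n]\to[m]$ nondecreasing let $g^*\colon\Omega_m\to\Omega_n$ be the pull-back along the affine map $e_i\mapsto e_{g(i)}$, and let $I(n,m)$ be the set of strictly increasing maps $[n]\to[m]$. Let $\int_{\Delta^n}\colon\Omega_n\to\mathbb K$ be the linear map vanishing on $\Omega_n^p$ for $p\ne n$ with $$\int_{\Delta^n}x_0^{k_0}\cdots x_n^{k_n}\,dx_0\wedge\dots\wedge\widehat{dx_i}\wedge\dots\wedge dx_n=(-1)^i\frac{k_0!\cdots k_n!}{(k_0+\dots+k_n+n)!}.$$ For $f\colon[n]\to[m]$ nondecreasing, the Whitney elementary form is $$\omega_f=n!\sum_{i=0}^n(-1)^i x_{f(i)}\,dx_{f(0)}\wedge\dots\wedge\widehat{dx_{f(i)}}\wedge\dots\wedge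 dx_{f(n)}\in\Omega_m^n,$$ and $\mathcal C_m\subset\Omega_m$ is the span of these forms, with inclusion $i_m$. Define $$\pi_m(\eta)=\sum_{n=0}^m\sum_{f\in I(n,m)}\Big(\int_{\Delta^n}f^*\eta\Big)\omega_f .$$ Let $\widehat\Delta^n=\{(s,t_0,\dots,t_n): s+\sum_i t_i=1\}$, regarded as the standard $(n+1)$-simplex with coordinates in this order, and let $\widehat\Omega_n$ be its algebra of polynomial forms. For $f\in I(n,m)$ let $\widehat f\colon\widehat\Delta^n\times\Delta^m_{\mathbb K}\to\Delta^m_{\mathbb K}$, $((s,t),v)\mapsto sv+\sum_i t_i e_{f(i)}$, let $k_f$ be the composite $$\Omega_m\xrightarrow{\ \widehat f^*\ }\widehat\Omega_n\otimes\Omega_m\xrightarrow{\ \int_{\widehat\Delta^n}\otimes\mathrm{Id}\ }\Omega_m,$$ where $\widehat\Omega_n\otimes\Omega_m$ is the tensor product of graded algebras (with the Koszul sign rule), and set $$k_m(\eta)=\sum_{n=0}^m\sum_{f\in I(n,m)}\omega_f\wedge k_f(\eta).$$ Then: 1. for every $m\ge0$, $\pi_m$ is a projector onto $\mathcal C_m$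 (its values lie in $\mathcal C_m$ and it is the identity on $\mathcal C_m$); 2. for every $m\ge 0$, $k_md+dk_m=i_m\pi_m-\mathrm{Id}_{\Omega_m}$; 3. for all $p,m\ge 0$ and every nondecreasing $g\colon[p]\to[m]$, $k_pg^*=g^*k_m$. Consequently $(\mathcal C_\bullet,\Omega_\bullet,i_\bullet,k_\bullet,\pi_\bullet)$ is a simplicial contraction. That is: each $\mathcal C_m$ is a graded subspace of $\Omega_m$ stable under $d$, and $g^*\mathcal C_m\subset\mathcal C_p$ for every nondecreasing $g\colon[p]\to[m]$; $i_m$ and $\pi_m\colon\Omega_m\to\mathcal C_m$ are morphisms of DG-vector spaces, $k_m$ has degree $-1$, $\pi_mi_m=\mathrm{Id}$ and $i_m\pi_m-\mathrm{Id}=dk_m+k_md$; and the pull-backs $g^*$ are functorial morphisms of DG-vector spaces $\Omega_m\to\Omega_p$ which commute with the operators $k$, the induced map $\pi_p g^* i_m\colon\mathcal C_m\to\mathcal C_p$ being the restriction of $g^*$. -/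

import Mathlib

open scoped TensorProduct DirectSum

noncomputable section

namespace PolyForm

variable (K : Type*) [Field K]

/-- The free graded-commutative algebra `K[x₀, …, xₙ, dx₀, …, dxₙ]`. -/
abbrev Free (n : ℕ) : Type _ :=
  MvPolynomial (Fin (n + 1)) K ⊗[K] ExteriorAlgebra K (Fin (n + 1) → K)

/-- The element `x₀ + ⋯ + xₙ - 1`. -/
def relX (n : ℕ) : Free K n := ((∑ i, MvPolynomial.X i) - 1) ⊗ₜ 1

/-- The element `dx₀ + ⋯ + dxₙ`. -/
def relDX (n : ℕ) : Free K n := 1 ⊗ₜ (∑ i, ExteriorAlgebra.ι K (Pi.single i 1))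

/-- The two-sided ideal `(∑ xᵢ - 1, ∑ dxᵢ)`. -/
def relIdeal (n : ℕ) : Ideal (Free K n) :=
  (TwoSidedIdeal.span {relX K n, relDX K n}).asIdeal

instance (n : ℕ) : (relIdeal K n).IsTwoSided :=
  inferInstanceAs (TwoSidedIdeal.span {relX K n, relDX K n}).asIdeal.IsTwoSided

/-- Polynomial differential forms on the affine standard `n`-simplex. -/
def Omega (n : ℕ) : Type _ := Free K n ⧸ relIdeal K n

instance (n : ℕ) : Ring (Omega K n) := inferInstanceAs (Ring (Free K n ⧸ relIdeal K n))
instance (n : ℕ) : Algebra K (Omega K n) :=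
  inferInstanceAs (Algebra K (Free K n ⧸ relIdeal K n))

/-- The quotient map from the free graded-commutative algebra. -/
def mk (n : ℕ) : Free K n →ₐ[K] Omega K n := Ideal.Quotient.mkₐ K (relIdeal K n)

/-- The coordinate function `xᵢ`. -/
def x {n : ℕ} (i : Fin (n + 1)) : Omega K n := mk K n (MvPolynomial.X i ⊗ₜ 1)

/-- The differential `dxᵢ`. -/
def dx {n : ℕ} (i : Fin (n + 1)) : Omega K n :=
  mk K n (1 ⊗ₜ ExteriorAlgebra.ι K (Pi.single i 1))

/-- The subspace of `p`-forms. -/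
def grade (n p : ℕ) : Submodule K (Omega K n) :=
  Submodule.span K
    {ω | ∃ (q : MvPolynomial (Fin (n + 1)) K)
      (w : ExteriorAlgebra K (Fin (n + 1) → K)),
        w ∈ ⋀[K]^p (Fin (n + 1) → K) ∧ ω = mk K n (q ⊗ₜ w)}

variable {K}

theorem mk_surjective (n : ℕ) : Function.Surjective (mk K n) :=
  Ideal.Quotient.mkₐ_surjective K _

theorem mk_eq_zero {n : ℕ} {z : Free K n} (hz : z ∈ relIdeal K n) : mk K n z = 0 :=
  Ideal.Quotient.eq_zero_iff_mem.2 hz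

theorem relX_mem (n : ℕ) : relX K n ∈ relIdeal K n :=
  TwoSidedIdeal.mem_asIdeal.2 (TwoSidedIdeal.subset_span (by simp))

theorem relDX_mem (n : ℕ) : relDX K n ∈ relIdeal K n :=
  TwoSidedIdeal.mem_asIdeal.2 (TwoSidedIdeal.subset_span (by simp))

/-- A linear map sends the ideal of relations into a subspace as soon as it does so on
monomial multiples of the two generators. -/
theorem map_relIdeal_le {n : ℕ} {N : Type*} [AddCommGroup N] [Module K N]
    (φ : Free K n →ₗ[K] N) (J : Submodule K N)
    (hX : ∀ p w q v, φ ((p ⊗ₜ w) * relX K n * (q ⊗ₜ v)) ∈ J)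
    (hD : ∀ p w q v, φ ((p ⊗ₜ w) * relDX K n * (q ⊗ₜ v)) ∈ J)
    {z : Free K n} (hz : z ∈ relIdeal K n) : φ z ∈ J := by
  have key : ∀ r : Free K n, (∀ p w q v, φ ((p ⊗ₜ w) * r * (q ⊗ₜ v)) ∈ J) →
      ∀ u v : Free K n, φ (u * r * v) ∈ J := by
    intro r hr u v
    induction u using TensorProduct.induction_on with
    | zero => simp
    | add a b ha hb => rw [add_mul, add_mul, map_add]; exact J.add_mem ha hb
    | tmul p w =>
      induction v using TensorProduct.induction_on with
      | zero => simp
      | add a b ha hb => rw [mul_add, map_add]; exact J.add_mem ha hb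
      | tmul q v => exact hr p w q v
  have hz' := TwoSidedIdeal.mem_span_iff_mem_addSubgroup_closure.1 (TwoSidedIdeal.mem_asIdeal.1 hz)
  induction hz' using AddSubgroup.closure_induction with
  | mem y hy =>
    obtain ⟨_, ⟨u, -, r, hr, rfl⟩, v, -, rfl⟩ := hy
    rcases hr with rfl | rfl
    · exact key _ hX u v
    · exact key _ hD u v
  | zero => simp
  | add a b ha hb h1 h2 =>
    rw [map_add]
    exact J.add_mem
      (h1 (TwoSidedIdeal.mem_asIdeal.2 (TwoSidedIdeal.mem_span_iff_mem_addSubgroup_closure.2 ha)))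
      (h2 (TwoSidedIdeal.mem_asIdeal.2 (TwoSidedIdeal.mem_span_iff_mem_addSubgroup_closure.2 hb)))
  | neg a ha h1 =>
    rw [map_neg]
    exact J.neg_mem
      (h1 (TwoSidedIdeal.mem_asIdeal.2 (TwoSidedIdeal.mem_span_iff_mem_addSubgroup_closure.2 ha)))

variable (K) in
/-- The differential of the free algebra,
`d (q dx_S) = ∑ᵢ (∂q/∂xᵢ) dxᵢ ∧ dx_S`. -/
def freeD (n : ℕ) : Free K n →ₗ[K] Free K n :=
  ∑ i : Fin (n + 1), TensorProduct.map (MvPolynomial.pderiv (R := K) i).toLinearMap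
    (LinearMap.mulLeft K (ExteriorAlgebra.ι K (Pi.single i (1 : K))))

theorem freeD_tmul {n : ℕ} (q : MvPolynomial (Fin (n + 1)) K)
    (w : ExteriorAlgebra K (Fin (n + 1) → K)) :
    freeD K n (q ⊗ₜ w) = ∑ i : Fin (n + 1),
      MvPolynomial.pderiv i q ⊗ₜ (ExteriorAlgebra.ι K (Pi.single i (1 : K)) * w) := by
  simp [freeD]

theorem freeD_mem {n : ℕ} {z : Free K n} (hz : z ∈ relIdeal K n) :
    freeD K n z ∈ relIdeal K n := by
  refine map_relIdeal_le (freeD K n) ((relIdeal K n).restrictScalars K) ?_ ?_ hz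
  · intro p w q v
    have e : freeD K n ((p ⊗ₜ w) * relX K n * (q ⊗ₜ v)) =
        (∑ i : Fin (n + 1), MvPolynomial.pderiv i (p * q) ⊗ₜ
          (ExteriorAlgebra.ι K (Pi.single i (1 : K)) * (w * v))) * relX K n +
        (p * q) ⊗ₜ 1 * relDX K n * (1 ⊗ₜ (w * v)) := by
      have e1 : (p ⊗ₜ w) * relX K n * (q ⊗ₜ v) =
          ((p * q) * ((∑ i, MvPolynomial.X i) - 1)) ⊗ₜ[K] (w * v) := by
        simp only [relX, Algebra.TensorProduct.tmul_mul_tmul, mul_one]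
        congr 1; ring
      rw [e1, freeD_tmul]
      simp only [relX, relDX, Algebra.TensorProduct.tmul_mul_tmul, mul_one, one_mul,
        Finset.sum_mul, Finset.mul_sum, TensorProduct.tmul_sum]
      rw [← Finset.sum_add_distrib]
      refine Finset.sum_congr rfl fun i _ => ?_
      rw [← TensorProduct.add_tmul]
      congr 1
      rw [Derivation.leibniz]
      simp only [map_sub, map_sum, MvPolynomial.pderiv_X, smul_eq_mul, Derivation.map_one_eq_zero,
        sub_zero]
      simp [Pi.single_apply]
      ring
    rw [e]
    exact Ideal.add_mem _ ((relIdeal K n).mul_mem_left _ (relX_mem n))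
      ((relIdeal K n).mul_mem_right _ ((relIdeal K n).mul_mem_left _ (relDX_mem n)))
  · intro p w q v
    have e : freeD K n ((p ⊗ₜ w) * relDX K n * (q ⊗ₜ v)) =
        (∑ i : Fin (n + 1), MvPolynomial.pderiv i (p * q) ⊗ₜ
          (ExteriorAlgebra.ι K (Pi.single i (1 : K)) * w)) * relDX K n * (1 ⊗ₜ v) := by
      simp only [relDX, Algebra.TensorProduct.tmul_mul_tmul, mul_one, freeD_tmul, Finset.sum_mul,
        mul_assoc]
    rw [e]
    exact (relIdeal K n).mul_mem_right _ ((relIdeal K n).mul_mem_left _ (relDX_mem n))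

variable (K) in
/-- The exterior derivative of polynomial forms, induced by `freeD`. -/
def d (n : ℕ) : Omega K n →ₗ[K] Omega K n :=
  Submodule.liftQ ((relIdeal K n).restrictScalars K) ((mk K n).toLinearMap ∘ₗ freeD K n)
    fun _ hz => mk_eq_zero (freeD_mem hz)

theorem d_mk {n : ℕ} (z : Free K n) : d K n (mk K n z) = mk K n (freeD K n z) := rfl

/-! ### Integration -/

variable (K) in
/-- The linear functional `x^k ↦ k₀! ⋯ kₙ! / (k₀ + ⋯ + kₙ + n)!` on polynomials. -/
def moment (n : ℕ) : MvPolynomial (Fin (n + 1)) K →ₗ[K] K :=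
  (MvPolynomial.basisMonomials (Fin (n + 1)) K).constr K fun k =>
    ((∏ i, (k i).factorial : ℕ) : K) / (((∑ i, k i) + n).factorial : K)

variable (K) in
/-- The coefficient of `dx₀ ∧ ⋯ ∧ dxₙ` in a constant form. -/
def topCoeff (n : ℕ) : ExteriorAlgebra K (Fin (n + 1) → K) →ₗ[K] K :=
  ExteriorAlgebra.liftAlternating
    (Pi.single (M := fun i => (Fin (n + 1) → K) [⋀^Fin i]→ₗ[K] K) (n + 1)
      Matrix.detRowAlternating)

variable (K) in
/-- The functional on constant forms that is `(-1)^i` on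
`dx₀ ∧ ⋯ ∧ (omit dxᵢ) ∧ ⋯ ∧ dxₙ`, and zero in all degrees other than `n`:
the top coefficient of `(∑ⱼ dxⱼ) ∧ w`. -/
def orient (n : ℕ) : ExteriorAlgebra K (Fin (n + 1) → K) →ₗ[K] K :=
  topCoeff K n ∘ₗ LinearMap.mulLeft K (∑ i, ExteriorAlgebra.ι K (Pi.single i (1 : K)))

variable (K) in
/-- Integration on the free algebra. -/
def freeIntegral (n : ℕ) : Free K n →ₗ[K] K :=
  LinearMap.mul' K K ∘ₗ TensorProduct.map (moment K n) (orient K n)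

theorem moment_monomial {n : ℕ} (k : Fin (n + 1) →₀ ℕ) :
    moment K n (MvPolynomial.monomial k 1) =
      ((∏ i, (k i).factorial : ℕ) : K) / (((∑ i, k i) + n).factorial : K) := by
  have := (MvPolynomial.basisMonomials (Fin (n + 1)) K).constr_basis K (fun k =>
    ((∏ i, (k i).factorial : ℕ) : K) / (((∑ i, k i) + n).factorial : K)) k
  rwa [MvPolynomial.coe_basisMonomials] at this

theorem freeIntegral_tmul {n : ℕ} (q : MvPolynomial (Fin (n + 1)) K)
    (w : ExteriorAlgebra K (Fin (n + 1) → K)) :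
    freeIntegral K n (q ⊗ₜ w) = moment K n q * orient K n w := by
  simp [freeIntegral]

theorem moment_mul_rel [CharZero K] {n : ℕ} (q : MvPolynomial (Fin (n + 1)) K) :
    moment K n (q * ((∑ i, MvPolynomial.X i) - 1)) = 0 := by
  suffices h : moment K n ∘ₗ LinearMap.mulRight K
      ((∑ i, MvPolynomial.X i) - 1 : MvPolynomial (Fin (n + 1)) K) = 0 from
    LinearMap.congr_fun h q
  refine (MvPolynomial.basisMonomials (Fin (n + 1)) K).ext fun k => ?_
  simp only [MvPolynomial.coe_basisMonomials, LinearMap.comp_apply, LinearMap.mulRight_apply,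
    mul_sub, mul_one, Finset.mul_sum, map_sub, map_sum, LinearMap.zero_apply]
  have h1 : ∀ j : Fin (n + 1), moment K n (MvPolynomial.monomial k 1 * MvPolynomial.X j) =
      ((k j : K) + 1) * ((∏ i, (k i).factorial : ℕ) : K) /
        (((∑ i, k i) + n + 1).factorial : K) := by
    intro j
    rw [MvPolynomial.X, MvPolynomial.monomial_mul, one_mul, moment_monomial]
    have e1 : ∏ i, ((k + Finsupp.single j 1 : Fin (n + 1) →₀ ℕ) i).factorial =
        (k j + 1) * ∏ i, (k i).factorial := by
      rw [← Finset.mul_prod_erase _ _ (Finset.mem_univ j),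
        ← Finset.mul_prod_erase Finset.univ (fun i => (k i).factorial) (Finset.mem_univ j),
        ← mul_assoc]
      congr 1
      · simp [Nat.factorial_succ]
      · refine Finset.prod_congr rfl fun i hi => ?_
        simp [(Finset.ne_of_mem_erase hi).symm]
    have e2 : ∑ i, (k + Finsupp.single j 1 : Fin (n + 1) →₀ ℕ) i + n = ∑ i, k i + n + 1 := by
      simp [Finset.sum_add_distrib, Finsupp.single_apply]
      ring
    rw [e1, e2]
    push_cast
    rfl
  simp only [h1, moment_monomial]
  rw [← Finset.sum_div, ← Finset.sum_mul, Nat.factorial_succ]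
  have h2 : (((∑ i, k i) + n).factorial : K) ≠ 0 := by exact_mod_cast Nat.factorial_ne_zero _
  have h3 : (((∑ i, k i) + n + 1 : ℕ) : K) ≠ 0 :=
    Nat.cast_ne_zero.2 (Nat.succ_ne_zero _)
  have h4 : ∑ i, ((k i : K) + 1) = (((∑ i, k i) + n + 1 : ℕ) : K) := by
    simp [Finset.sum_add_distrib]; ring
  rw [h4]
  push_cast at *
  field_simp
  simp

theorem ι_mul_eq {M : Type*} [AddCommGroup M] [Module K M] (m : M) (w : ExteriorAlgebra K M) :
    ExteriorAlgebra.ι K m * w = CliffordAlgebra.involute w * ExteriorAlgebra.ι K m := by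
  induction w using ExteriorAlgebra.induction with
  | algebraMap r => rw [AlgHom.commutes, Algebra.commutes]
  | ι v =>
    rw [show CliffordAlgebra.involute (ExteriorAlgebra.ι K v) = -ExteriorAlgebra.ι K v from
      CliffordAlgebra.involute_ι v, neg_mul]
    exact eq_neg_of_add_eq_zero_left (ExteriorAlgebra.ι_add_mul_swap m v)
  | mul a b ha hb => rw [← mul_assoc, ha, mul_assoc, hb, ← mul_assoc, ← map_mul]
  | add a b ha hb => rw [mul_add, ha, hb, map_add, add_mul]

theorem freeIntegral_eq_zero [CharZero K] {n : ℕ} {z : Free K n} (hz : z ∈ relIdeal K n) :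
    freeIntegral K n z = 0 := by
  refine map_relIdeal_le (freeIntegral K n) ⊥ ?_ ?_ hz
  · intro p w q v
    rw [Submodule.mem_bot, relX, Algebra.TensorProduct.tmul_mul_tmul,
      Algebra.TensorProduct.tmul_mul_tmul, freeIntegral_tmul, mul_right_comm, moment_mul_rel,
      zero_mul]
  · intro p w q v
    rw [Submodule.mem_bot, relDX, Algebra.TensorProduct.tmul_mul_tmul,
      Algebra.TensorProduct.tmul_mul_tmul, freeIntegral_tmul, orient, LinearMap.comp_apply,
      LinearMap.mulLeft_apply, ← map_sum, ← mul_assoc, ← mul_assoc, ι_mul_eq, mul_assoc _ _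
      (ExteriorAlgebra.ι K _), ExteriorAlgebra.ι_sq_zero]
    simp

variable (K) in
/-- Integration over the affine standard `n`-simplex. -/
def integral [CharZero K] (n : ℕ) : Omega K n →ₗ[K] K :=
  Submodule.liftQ ((relIdeal K n).restrictScalars K) (freeIntegral K n)
    fun _ hz => freeIntegral_eq_zero hz

theorem integral_mk [CharZero K] {n : ℕ} (z : Free K n) :
    integral K n (mk K n z) = freeIntegral K n z := rfl

/-- The integral vanishes on `p`-forms with `p ≠ n`. -/
theorem integral_of_ne [CharZero K] {n p : ℕ} (hp : p ≠ n) {η : Omega K n}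
    (hη : η ∈ grade K n p) : integral K n η = 0 := by
  induction hη using Submodule.span_induction with
  | mem η h =>
    obtain ⟨q, w, hw, rfl⟩ := h
    suffices orient K n w = 0 by
      rw [integral_mk, freeIntegral_tmul, this, mul_zero]
    rw [← ExteriorAlgebra.ιMulti_span_fixedDegree] at hw
    induction hw using Submodule.span_induction with
    | mem w h =>
      obtain ⟨v, rfl⟩ := h
      rw [orient, LinearMap.comp_apply, LinearMap.mulLeft_apply, ← map_sum, topCoeff,
        ExteriorAlgebra.ιMulti_apply]
      have e : ExteriorAlgebra.ι K (∑ i : Fin (n + 1), Pi.single i (1 : K)) *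
          (List.ofFn fun i => ExteriorAlgebra.ι K (v i)).prod =
          ExteriorAlgebra.ιMulti K (p + 1)
            (Fin.cons (∑ i : Fin (n + 1), Pi.single i (1 : K)) v) := by
        rw [ExteriorAlgebra.ιMulti_apply, List.ofFn_succ]; simp
      rw [e, ExteriorAlgebra.liftAlternating_apply_ιMulti, Pi.single_eq_of_ne (by omega)]
      rfl
    | zero => simp
    | add a b _ _ ha hb => rw [map_add, ha, hb, add_zero]
    | smul c a _ ha => rw [map_smul, ha, smul_zero]
  | zero => simp
  | add a b _ _ ha hb => rw [map_add, ha, hb, add_zero]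
  | smul c a _ ha => rw [map_smul, ha, smul_zero]

theorem det_cons_single {n : ℕ} (i : Fin (n + 1)) :
    Matrix.det (Matrix.of (Fin.cons (∑ i : Fin (n + 1), Pi.single i (1 : K))
      fun j => Pi.single (i.succAbove j) (1 : K))) = (-1) ^ (i : ℕ) := by
  rw [Matrix.det_succ_row_zero, Finset.sum_eq_single i]
  · have h2 : Matrix.submatrix (Matrix.of (Fin.cons (∑ i : Fin (n + 1), Pi.single i (1 : K))
        fun j => Pi.single (i.succAbove j) (1 : K))) Fin.succ i.succAbove = 1 := by
      ext a b
      simp [Matrix.one_apply, Pi.single_apply, eq_comm]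
    rw [h2, Matrix.det_one]
    simp [Finset.sum_apply, Pi.single_apply]
  · intro j _ hj
    obtain ⟨a, ha⟩ := Fin.exists_succAbove_eq hj
    rw [Matrix.det_eq_zero_of_row_eq_zero a, mul_zero]
    intro b
    simp [ha, Fin.succAbove_ne]
  · simp

/-- The values of the integral on top-degree monomial forms. -/
theorem integral_monomial [CharZero K] {n : ℕ} (k : Fin (n + 1) → ℕ) (i : Fin (n + 1)) :
    integral K n ((List.ofFn fun j => x K j ^ k j).prod *
        (List.ofFn fun j : Fin n => dx K (i.succAbove j)).prod) =
      (-1) ^ (i : ℕ) * ((∏ j, ((k j).factorial : K)) / (((∑ j, k j) + n).factorial : K)) := by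
  have e1 : (List.ofFn fun j => x K j ^ k j).prod =
      mk K n (MvPolynomial.monomial (Finsupp.equivFunOnFinite.symm k) 1 ⊗ₜ 1) := by
    have : (MvPolynomial.monomial (Finsupp.equivFunOnFinite.symm k) (1 : K) :
        MvPolynomial (Fin (n + 1)) K) ⊗ₜ[K] (1 : ExteriorAlgebra K (Fin (n + 1) → K)) =
        (List.ofFn fun j : Fin (n + 1) => ((MvPolynomial.X j : MvPolynomial (Fin (n + 1)) K) ⊗ₜ[K]
          (1 : ExteriorAlgebra K (Fin (n + 1) → K))) ^ k j).prod := by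
      rw [MvPolynomial.monomial_eq, Finsupp.prod_fintype _ _ (by simp), ← List.prod_ofFn]
      simp only [map_one, one_mul]
      have := map_list_prod (Algebra.TensorProduct.includeLeft (R := K) (S := K)
        (A := MvPolynomial (Fin (n + 1)) K) (B := ExteriorAlgebra K (Fin (n + 1) → K)))
        (List.ofFn fun j : Fin (n + 1) => (MvPolynomial.X j : MvPolynomial (Fin (n + 1)) K) ^ k j)
      simp only [List.map_ofFn, Function.comp_def, map_pow,
        Algebra.TensorProduct.includeLeft_apply] at this
      exact this
    rw [this, map_list_prod]
    simp only [List.map_ofFn, Function.comp_def, map_pow, x]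
  have e2 : (List.ofFn fun j : Fin n => dx K (i.succAbove j)).prod =
      mk K n (1 ⊗ₜ ExteriorAlgebra.ιMulti K n fun j => Pi.single (i.succAbove j) (1 : K)) := by
    have := map_list_prod (Algebra.TensorProduct.includeRight (R := K)
        (A := MvPolynomial (Fin (n + 1)) K) (B := ExteriorAlgebra K (Fin (n + 1) → K)))
        (List.ofFn fun j : Fin n => ExteriorAlgebra.ι K (Pi.single (i.succAbove j) (1 : K)))
    rw [ExteriorAlgebra.ιMulti_apply]
    simp only [Algebra.TensorProduct.includeRight_apply] at this
    rw [this, map_list_prod]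
    simp only [List.map_ofFn, Function.comp_def, dx]
    rfl
  rw [e1, e2, ← map_mul, Algebra.TensorProduct.tmul_mul_tmul, mul_one, one_mul]
  rw [integral_mk, freeIntegral_tmul, moment_monomial, mul_comm]
  congr 1
  · rw [orient, LinearMap.comp_apply, LinearMap.mulLeft_apply, ← map_sum, topCoeff]
    have e : ExteriorAlgebra.ι K (∑ i : Fin (n + 1), Pi.single i (1 : K)) *
          ExteriorAlgebra.ιMulti K n (fun j => Pi.single (i.succAbove j) (1 : K)) =
          ExteriorAlgebra.ιMulti K (n + 1)
            (Fin.cons (∑ i : Fin (n + 1), Pi.single i (1 : K))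
              fun j => Pi.single (i.succAbove j) (1 : K)) := by
      rw [ExteriorAlgebra.ιMulti_apply, ExteriorAlgebra.ιMulti_apply, List.ofFn_succ]; simp
    rw [e, ExteriorAlgebra.liftAlternating_apply_ιMulti, Pi.single_eq_same]
    exact det_cons_single i
  · simp

/-! ### Algebra maps out of `Omega`, and the grading -/

section Lift

variable {B : Type*} [Ring B] [Algebra K B] {n : ℕ}

/-- The algebra map out of the free graded-commutative algebra with prescribed values. -/
def freeLift (f : MvPolynomial (Fin (n + 1)) K →ₐ[K] B) (θ : (Fin (n + 1) → K) →ₗ[K] B)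
    (hsq : ∀ v, θ v * θ v = 0) (hcomm : ∀ q v, Commute (f q) (θ v)) : Free K n →ₐ[K] B :=
  Algebra.TensorProduct.lift f (ExteriorAlgebra.lift K ⟨θ, hsq⟩) (by
    intro q w
    induction w using ExteriorAlgebra.induction with
    | algebraMap r => rw [AlgHom.commutes]; exact (Algebra.commutes r _).symm
    | ι v => rw [ExteriorAlgebra.lift_ι_apply]; exact hcomm q v
    | mul a b ha hb => rw [map_mul]; exact ha.mul_right hb
    | add a b ha hb => rw [map_add]; exact ha.add_right hb)

/-- The universal property of `Omega K n`: an algebra map is given by the images of the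
polynomials and of the `dxᵢ`. -/
def lift (f : MvPolynomial (Fin (n + 1)) K →ₐ[K] B) (θ : (Fin (n + 1) → K) →ₗ[K] B)
    (hsq : ∀ v, θ v * θ v = 0) (hcomm : ∀ q v, Commute (f q) (θ v))
    (hX : f (∑ i, MvPolynomial.X i) = 1) (hD : ∑ i, θ (Pi.single i 1) = 0) :
    Omega K n →ₐ[K] B :=
  Ideal.Quotient.liftₐ (relIdeal K n) (freeLift f θ hsq hcomm) (by
    intro z hz
    refine map_relIdeal_le (freeLift f θ hsq hcomm).toLinearMap ⊥ ?_ ?_ hz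
    · intro p w q v
      have : freeLift f θ hsq hcomm (relX K n) = 0 := by
        rw [relX, freeLift, Algebra.TensorProduct.lift_tmul, map_sub, hX, map_one, map_one,
          sub_self, zero_mul]
      rw [AlgHom.toLinearMap_apply, map_mul, map_mul, this, mul_zero, zero_mul, Submodule.mem_bot]
    · intro p w q v
      have : freeLift f θ hsq hcomm (relDX K n) = 0 := by
        simp only [relDX, freeLift, Algebra.TensorProduct.lift_tmul, map_sum,
          ExteriorAlgebra.lift_ι_apply, hD, mul_zero]
      rw [AlgHom.toLinearMap_apply, map_mul, map_mul, this, mul_zero, zero_mul, Submodule.mem_bot])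

theorem lift_mk (f : MvPolynomial (Fin (n + 1)) K →ₐ[K] B) (θ : (Fin (n + 1) → K) →ₗ[K] B)
    (hsq hcomm hX hD) (q : MvPolynomial (Fin (n + 1)) K)
    (w : ExteriorAlgebra K (Fin (n + 1) → K)) :
    lift f θ hsq hcomm hX hD (mk K n (q ⊗ₜ w)) = f q * ExteriorAlgebra.lift K ⟨θ, hsq⟩ w := rfl

theorem algHom_ext {f g : Omega K n →ₐ[K] B} (hx : ∀ i, f (x K i) = g (x K i))
    (hdx : ∀ i, f (dx K i) = g (dx K i)) : f = g := by
  refine Ideal.Quotient.algHom_ext K (?_ : f.comp (mk K n) = g.comp (mk K n))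
  ext i
  · exact hx i
  · exact hdx i

end Lift

/-- A polynomial as a `0`-form. -/
def poly (n : ℕ) : MvPolynomial (Fin (n + 1)) K →ₐ[K] Omega K n :=
  (mk K n).comp Algebra.TensorProduct.includeLeft

/-- A covector as a constant `1`-form. -/
def covec (n : ℕ) : (Fin (n + 1) → K) →ₗ[K] Omega K n :=
  (mk K n).toLinearMap ∘ₗ (Algebra.TensorProduct.includeRight (R := K)
    (A := MvPolynomial (Fin (n + 1)) K)).toLinearMap ∘ₗ ExteriorAlgebra.ι K

theorem poly_X {n : ℕ} (i : Fin (n + 1)) : poly n (MvPolynomial.X i) = x K i := rfl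

theorem covec_single {n : ℕ} (i : Fin (n + 1)) : covec n (Pi.single i 1) = dx K i := rfl

theorem lift_poly {B : Type*} [Ring B] [Algebra K B] {n : ℕ}
    (f : MvPolynomial (Fin (n + 1)) K →ₐ[K] B) (θ : (Fin (n + 1) → K) →ₗ[K] B)
    (hsq hcomm hX hD) (q : MvPolynomial (Fin (n + 1)) K) :
    lift f θ hsq hcomm hX hD (poly n q) = f q := by
  rw [poly, AlgHom.comp_apply, Algebra.TensorProduct.includeLeft_apply, lift_mk, map_one, mul_one]

theorem lift_covec {B : Type*} [Ring B] [Algebra K B] {n : ℕ}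
    (f : MvPolynomial (Fin (n + 1)) K →ₐ[K] B) (θ : (Fin (n + 1) → K) →ₗ[K] B)
    (hsq hcomm hX hD) (v : Fin (n + 1) → K) :
    lift f θ hsq hcomm hX hD (covec n v) = θ v := by
  rw [covec, LinearMap.comp_apply, LinearMap.comp_apply, AlgHom.toLinearMap_apply,
    AlgHom.toLinearMap_apply, Algebra.TensorProduct.includeRight_apply, lift_mk, map_one, one_mul,
    ExteriorAlgebra.lift_ι_apply]

theorem covec_sq {n : ℕ} (v : Fin (n + 1) → K) : covec n v * covec n v = 0 := by
  simp only [covec, LinearMap.comp_apply, AlgHom.toLinearMap_apply]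
  rw [← map_mul, ← map_mul, ExteriorAlgebra.ι_sq_zero, map_zero, map_zero]

theorem poly_commute {n : ℕ} (q : MvPolynomial (Fin (n + 1)) K) (z : Omega K n) :
    Commute (poly n q) z := by
  obtain ⟨z, rfl⟩ := mk_surjective n z
  refine Commute.map (f := mk K n) (x := q ⊗ₜ 1) ?_
  induction z using TensorProduct.induction_on with
  | zero => exact Commute.zero_right _
  | add a b ha hb => exact ha.add_right hb
  | tmul p w =>
    simp [Commute, SemiconjBy, mul_comm]

theorem poly_sum {n : ℕ} : poly n (∑ i, MvPolynomial.X i : MvPolynomial (Fin (n + 1)) K) = 1 := by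
  have h := mk_eq_zero (relX_mem (K := K) n)
  rw [relX, TensorProduct.sub_tmul, map_sub, sub_eq_zero] at h
  exact h.trans (map_one (mk K n))

theorem covec_sum {n : ℕ} : ∑ i, covec n (Pi.single i (1 : K) : Fin (n + 1) → K) = 0 := by
  have h := mk_eq_zero (relDX_mem (K := K) n)
  rw [relDX, TensorProduct.tmul_sum, map_sum] at h
  exact h

theorem poly_mem {n : ℕ} (q : MvPolynomial (Fin (n + 1)) K) : poly n q ∈ grade K n 0 :=
  Submodule.subset_span ⟨q, 1, by simp, rfl⟩

theorem covec_mem {n : ℕ} (v : Fin (n + 1) → K) : covec n v ∈ grade K n 1 :=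
  Submodule.subset_span ⟨1, ExteriorAlgebra.ι K v, by simp, rfl⟩

instance gradedMonoid (n : ℕ) : SetLike.GradedMonoid (grade K n) where
  one_mem := by simpa using poly_mem (K := K) (n := n) 1
  mul_mem i j a b ha hb := by
    induction ha, hb using Submodule.span_induction₂ with
    | mem_mem a b ha hb =>
      obtain ⟨q, w, hw, rfl⟩ := ha
      obtain ⟨p, v, hv, rfl⟩ := hb
      rw [← map_mul, Algebra.TensorProduct.tmul_mul_tmul]
      exact Submodule.subset_span ⟨_, _, SetLike.mul_mem_graded hw hv, rfl⟩
    | zero_left => simp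
    | zero_right => simp
    | add_left _ _ _ _ _ _ h1 h2 => rw [add_mul]; exact Submodule.add_mem _ h1 h2
    | add_right _ _ _ _ _ _ h1 h2 => rw [mul_add]; exact Submodule.add_mem _ h1 h2
    | smul_left r _ _ _ _ h => rw [smul_mul_assoc]; exact Submodule.smul_mem _ _ h
    | smul_right r _ _ _ _ h => rw [mul_smul_comm]; exact Submodule.smul_mem _ _ h

/-- Auxiliary map for the grading. -/
def polyGr (n : ℕ) : MvPolynomial (Fin (n + 1)) K →ₐ[K] ⨁ i, grade K n i :=
  AlgHom.ofLinearMap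
    (DirectSum.lof K ℕ (fun i => grade K n i) 0 ∘ₗ
      (poly n).toLinearMap.codRestrict (grade K n 0) poly_mem)
    (by
      rw [LinearMap.comp_apply, DirectSum.lof_eq_of, DirectSum.one_def]
      exact congrArg _ (Subtype.ext (map_one (poly n))))
    (by
      intro p q
      simp only [LinearMap.comp_apply, DirectSum.lof_eq_of]
      rw [DirectSum.of_mul_of]
      refine DirectSum.of_eq_of_gradedMonoid_eq (Sigma.subtype_ext (zero_add 0).symm ?_)
      exact map_mul (poly n) p q)

/-- Auxiliary map for the grading. -/
def covecGr (n : ℕ) : (Fin (n + 1) → K) →ₗ[K] ⨁ i, grade K n i :=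
  DirectSum.lof K ℕ (fun i => grade K n i) 1 ∘ₗ
      (covec n).codRestrict (grade K n 1) covec_mem

theorem polyGr_apply {n : ℕ} (q : MvPolynomial (Fin (n + 1)) K) :
    polyGr n q = DirectSum.of (fun i => grade K n i) 0 ⟨poly n q, poly_mem q⟩ := rfl

theorem covecGr_apply {n : ℕ} (v : Fin (n + 1) → K) :
    covecGr n v = DirectSum.of (fun i => grade K n i) 1 ⟨covec n v, covec_mem v⟩ := rfl

theorem covecGr_sq {n : ℕ} (v : Fin (n + 1) → K) : covecGr n v * covecGr n v = 0 := by
  rw [covecGr_apply, DirectSum.of_mul_of]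
  exact DFinsupp.single_eq_zero.mpr (Subtype.ext (covec_sq v))

theorem polyGr_commute {n : ℕ} (q : MvPolynomial (Fin (n + 1)) K) (v : Fin (n + 1) → K) :
    Commute (polyGr n q) (covecGr n v) := by
  rw [polyGr_apply, covecGr_apply, Commute, SemiconjBy, DirectSum.of_mul_of,
    DirectSum.of_mul_of]
  exact DirectSum.of_eq_of_gradedMonoid_eq
    (Sigma.subtype_ext (add_comm _ _) (poly_commute q (covec n v)).eq)

theorem polyGr_sum (n : ℕ) :
    polyGr n (∑ i, MvPolynomial.X i : MvPolynomial (Fin (n + 1)) K) = 1 := by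
  rw [polyGr_apply, DirectSum.one_def]
  exact congrArg _ (Subtype.ext poly_sum)

theorem covecGr_sum (n : ℕ) : ∑ i, covecGr n (Pi.single i (1 : K) : Fin (n + 1) → K) = 0 := by
  rw [← map_sum, covecGr_apply]
  refine DFinsupp.single_eq_zero.mpr (Subtype.ext ?_)
  exact (map_sum _ _ _).trans covec_sum

/-- Auxiliary map for the grading. -/
def toGr (n : ℕ) : Omega K n →ₐ[K] ⨁ i, grade K n i :=
  lift (K := K) (n := n) (B := ⨁ i, grade K n i) (polyGr n) (covecGr n) covecGr_sq polyGr_commute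
    (polyGr_sum (K := K) n) (covecGr_sum (K := K) n)

/-- `toGr` sends `η` to itself, placed in degree `i`. -/
def IsHom (n i : ℕ) (η : Omega K n) : Prop :=
  ∃ h : η ∈ grade K n i, toGr n η = DirectSum.of (fun i => grade K n i) i ⟨η, h⟩

theorem IsHom.zero (n i : ℕ) : IsHom n i (0 : Omega K n) :=
  ⟨Submodule.zero_mem _, by
    rw [map_zero]
    exact (map_zero (DirectSum.of (fun i => grade K n i) i)).symm⟩

theorem IsHom.add {n i : ℕ} {a b : Omega K n} (ha : IsHom n i a) (hb : IsHom n i b) :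
    IsHom n i (a + b) := by
  obtain ⟨ha, ea⟩ := ha
  obtain ⟨hb, eb⟩ := hb
  exact ⟨Submodule.add_mem _ ha hb, by rw [map_add, ea, eb, ← map_add, AddMemClass.mk_add_mk]⟩

theorem IsHom.smul {n i : ℕ} (c : K) {a : Omega K n} (ha : IsHom n i a) :
    IsHom n i (c • a) := by
  obtain ⟨ha, ea⟩ := ha
  exact ⟨Submodule.smul_mem _ c ha, by
    rw [map_smul, ea, ← DirectSum.lof_eq_of K, ← map_smul, SetLike.mk_smul_mk,
      DirectSum.lof_eq_of]⟩

theorem IsHom.mul {n i j k : ℕ} {a b : Omega K n} (ha : IsHom n i a) (hb : IsHom n j b)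
    (hk : i + j = k) : IsHom n k (a * b) := by
  subst hk
  obtain ⟨ha, ea⟩ := ha
  obtain ⟨hb, eb⟩ := hb
  exact ⟨SetLike.mul_mem_graded ha hb, by rw [map_mul, ea, eb, DirectSum.of_mul_of]; rfl⟩

theorem isHom_poly {n : ℕ} (q : MvPolynomial (Fin (n + 1)) K) : IsHom n 0 (poly n q) :=
  ⟨poly_mem q, by rw [← polyGr_apply, toGr, lift_poly]⟩

theorem isHom_covec {n : ℕ} (v : Fin (n + 1) → K) : IsHom n 1 (covec n v) :=
  ⟨covec_mem v, by rw [← covecGr_apply, toGr, lift_covec]⟩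

theorem mk_tmul {n : ℕ} (q : MvPolynomial (Fin (n + 1)) K)
    (w : ExteriorAlgebra K (Fin (n + 1) → K)) :
    mk K n (q ⊗ₜ w) = poly n q * mk K n (1 ⊗ₜ w) := by
  rw [poly, AlgHom.comp_apply, Algebra.TensorProduct.includeLeft_apply, ← map_mul,
    Algebra.TensorProduct.tmul_mul_tmul, mul_one, one_mul]

theorem mk_one_tmul_ι_mul {n : ℕ} (v : Fin (n + 1) → K)
    (w : ExteriorAlgebra K (Fin (n + 1) → K)) :
    mk K n (1 ⊗ₜ (ExteriorAlgebra.ι K v * w)) = covec n v * mk K n (1 ⊗ₜ w) := by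
  rw [covec, LinearMap.comp_apply, LinearMap.comp_apply, AlgHom.toLinearMap_apply,
    AlgHom.toLinearMap_apply, Algebra.TensorProduct.includeRight_apply, ← map_mul,
    Algebra.TensorProduct.tmul_mul_tmul, mul_one]

theorem isHom_mk {n i : ℕ} {w : ExteriorAlgebra K (Fin (n + 1) → K)}
    (hw : w ∈ ⋀[K]^i (Fin (n + 1) → K)) : IsHom n i (mk K n (1 ⊗ₜ w)) := by
  induction hw using Submodule.pow_induction_on_left' with
  | algebraMap r =>
    have h := (isHom_poly (n := n) (1 : MvPolynomial (Fin (n + 1)) K)).smul r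
    rwa [Algebra.algebraMap_eq_smul_one, TensorProduct.tmul_smul, map_smul,
      ← Algebra.TensorProduct.one_def, map_one (mk K n), ← map_one (poly n)]
  | add a b i ha hb iha ihb =>
    rw [TensorProduct.tmul_add, map_add]
    exact iha.add ihb
  | mem_mul m hm i a ha iha =>
    obtain ⟨v, rfl⟩ := hm
    rw [mk_one_tmul_ι_mul]
    exact (isHom_covec v).mul iha (add_comm _ _)

theorem isHom_of_mem {n i : ℕ} {η : Omega K n} (hη : η ∈ grade K n i) : IsHom n i η := by
  induction hη using Submodule.span_induction with
  | mem η h =>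
    obtain ⟨q, w, hw, rfl⟩ := h
    rw [mk_tmul]
    exact (isHom_poly q).mul (isHom_mk hw) (zero_add _)
  | zero => exact IsHom.zero n i
  | add a b _ _ h1 h2 => exact h1.add h2
  | smul c a _ h => exact h.smul c

theorem toGr_of_mem {n i : ℕ} (η : grade K n i) :
    toGr n (η : Omega K n) = DirectSum.of (fun i => grade K n i) i η :=
  (isHom_of_mem η.2).2

instance gradedAlgebra (n : ℕ) : GradedAlgebra (grade K n) :=
  GradedAlgebra.ofAlgHom (grade K n) (toGr n)
    (by
      refine algHom_ext (K := K) (n := n) (fun i => ?_) (fun i => ?_)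
      · rw [AlgHom.comp_apply, ← poly_X, toGr_of_mem ⟨_, poly_mem (MvPolynomial.X i)⟩,
          DirectSum.coeAlgHom_of]
        rfl
      · rw [AlgHom.comp_apply, ← covec_single, toGr_of_mem ⟨_, covec_mem (Pi.single i 1)⟩,
          DirectSum.coeAlgHom_of]
        rfl)
    (fun _ η => toGr_of_mem η)

/-! ### Pull-backs -/

/-- The substitution `xⱼ ↦ ∑_{g(i) = j} xᵢ` on polynomials. -/
def pullbackPoly {n m : ℕ} (g : Fin (n + 1) → Fin (m + 1)) :
    MvPolynomial (Fin (m + 1)) K →ₐ[K] Omega K n :=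
  (poly n).comp (MvPolynomial.aeval fun j => ∑ i with g i = j, MvPolynomial.X i)

/-- The substitution `dxⱼ ↦ ∑_{g(i) = j} dxᵢ` on covectors. -/
def pullbackCovec {n m : ℕ} (g : Fin (n + 1) → Fin (m + 1)) :
    (Fin (m + 1) → K) →ₗ[K] Omega K n :=
  covec n ∘ₗ LinearMap.funLeft K K g

theorem pullbackPoly_X {n m : ℕ} (g : Fin (n + 1) → Fin (m + 1)) (j : Fin (m + 1)) :
    pullbackPoly g (MvPolynomial.X j) = ∑ i with g i = j, x K i := by
  rw [pullbackPoly, AlgHom.comp_apply, MvPolynomial.aeval_X, map_sum]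
  rfl

theorem pullbackCovec_single {n m : ℕ} (g : Fin (n + 1) → Fin (m + 1)) (j : Fin (m + 1)) :
    pullbackCovec g (Pi.single j (1 : K)) = ∑ i with g i = j, dx K i := by
  simp only [← covec_single, ← map_sum, pullbackCovec, LinearMap.comp_apply]
  congr 1
  ext i
  simp [LinearMap.funLeft, Finset.sum_apply, Pi.single_apply]

theorem pullbackPoly_sum {n m : ℕ} (g : Fin (n + 1) → Fin (m + 1)) :
    pullbackPoly g (∑ j, MvPolynomial.X j : MvPolynomial (Fin (m + 1)) K) = 1 := by
  rw [map_sum]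
  simp only [pullbackPoly_X]
  rw [Finset.sum_fiberwise, ← poly_sum (K := K) (n := n), map_sum]
  rfl

theorem pullbackCovec_sum {n m : ℕ} (g : Fin (n + 1) → Fin (m + 1)) :
    ∑ j, pullbackCovec g (Pi.single j (1 : K)) = 0 := by
  simp only [pullbackCovec_single]
  rw [Finset.sum_fiberwise]
  exact covec_sum (K := K)

theorem pullbackCovec_sq {n m : ℕ} (g : Fin (n + 1) → Fin (m + 1)) (v : Fin (m + 1) → K) :
    pullbackCovec g v * pullbackCovec g v = 0 := by
  rw [pullbackCovec, LinearMap.comp_apply, covec_sq]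

theorem pullbackPoly_commute {n m : ℕ} (g : Fin (n + 1) → Fin (m + 1))
    (q : MvPolynomial (Fin (m + 1)) K) (v : Fin (m + 1) → K) :
    Commute (pullbackPoly g q) (pullbackCovec g v) := by
  rw [pullbackPoly, AlgHom.comp_apply]
  exact poly_commute _ _

/-- The pull-back along the affine map `Δⁿ → Δᵐ`, `eᵢ ↦ e_{g(i)}`:
`xⱼ ↦ ∑_{g(i) = j} xᵢ` and `dxⱼ ↦ ∑_{g(i) = j} dxᵢ`. -/
def pullback {n m : ℕ} (g : Fin (n + 1) → Fin (m + 1)) : Omega K m →ₐ[K] Omega K n :=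
  lift (K := K) (n := m) (B := Omega K n) (pullbackPoly g) (pullbackCovec g)
    (pullbackCovec_sq (K := K) g) (pullbackPoly_commute (K := K) g)
    (pullbackPoly_sum (K := K) g) (pullbackCovec_sum (K := K) g)

theorem pullback_x {n m : ℕ} (g : Fin (n + 1) → Fin (m + 1)) (j : Fin (m + 1)) :
    pullback g (x K j) = ∑ i with g i = j, x K i := by
  rw [← poly_X, pullback, lift_poly, pullbackPoly_X]

theorem pullback_dx {n m : ℕ} (g : Fin (n + 1) → Fin (m + 1)) (j : Fin (m + 1)) :
    pullback g (dx K j) = ∑ i with g i = j, dx K i := by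
  rw [← covec_single, pullback, lift_covec, pullbackCovec_single]

variable (K) in
/-- Forms on `Δ̂ⁿ × Δᵐ`, that is `Ω̂ₙ ⊗ Ωₘ` with the Koszul sign rule. The simplex `Δ̂ⁿ`, with
coordinates `(s, t₀, …, tₙ)` in this order, is the affine standard `(n+1)`-simplex. -/
abbrev HatOmega (n m : ℕ) : Type _ := grade K (n + 1) ᵍ⊗[K] grade K m

theorem x_mem {n : ℕ} (i : Fin (n + 1)) : x K i ∈ grade K n 0 := poly_mem _

theorem dx_mem {n : ℕ} (i : Fin (n + 1)) : dx K i ∈ grade K n 1 := covec_mem _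

theorem tmul_mul_tmul_of_mem {n m i j : ℕ} (a : Omega K (n + 1)) {b : Omega K m}
    (hb : b ∈ grade K m j) {a' : Omega K (n + 1)} (ha' : a' ∈ grade K (n + 1) i) (b' : Omega K m) :
    (a ᵍ⊗ₜ[K] b * a' ᵍ⊗ₜ[K] b' : HatOmega K n m) =
      (-1 : ℤˣ) ^ (j * i) • ((a * a') ᵍ⊗ₜ[K] (b * b') : HatOmega K n m) :=
  GradedTensorProduct.tmul_coe_mul_coe_tmul (grade K (n + 1)) (grade K m) a ⟨b, hb⟩ ⟨a', ha'⟩ b'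

variable (K) in
/-- Polynomial functions on `Δ̂ⁿ × Δᵐ` as forms. -/
def hatPoly (n m : ℕ) :
    MvPolynomial (Fin (n + 1 + 1)) K ⊗[K] MvPolynomial (Fin (m + 1)) K →ₐ[K] HatOmega K n m :=
  Algebra.TensorProduct.lift
    ((GradedTensorProduct.includeLeft (grade K (n + 1)) (grade K m)).comp (poly (n + 1)))
    ((GradedTensorProduct.includeRight (grade K (n + 1)) (grade K m)).comp (poly m))
    (fun p q => by
      change (poly (n + 1) p ᵍ⊗ₜ[K] (1 : Omega K m) * (1 : Omega K (n + 1)) ᵍ⊗ₜ[K] poly m q :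
        HatOmega K n m) = (1 : Omega K (n + 1)) ᵍ⊗ₜ[K] poly m q * poly (n + 1) p ᵍ⊗ₜ[K] 1
      rw [tmul_mul_tmul_of_mem _ (poly_mem q) (poly_mem p),
        tmul_mul_tmul_of_mem _ SetLike.GradedOne.one_mem SetLike.GradedOne.one_mem]
      simp)

/-- The pull-back of `xⱼ` along `((s, t), v) ↦ s v + ∑ᵢ tᵢ e_{f(i)}`, namely
`s xⱼ + ∑_{f(i) = j} tᵢ`. -/
def hatX {n m : ℕ} (f : Fin (n + 1) → Fin (m + 1)) (j : Fin (m + 1)) :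
    MvPolynomial (Fin (n + 1 + 1)) K ⊗[K] MvPolynomial (Fin (m + 1)) K :=
  MvPolynomial.X 0 ⊗ₜ MvPolynomial.X j + (∑ i with f i = j, MvPolynomial.X i.succ) ⊗ₜ 1

/-- The pull-back of `dxⱼ` along `((s, t), v) ↦ s v + ∑ᵢ tᵢ e_{f(i)}`, namely
`ds ⊗ xⱼ + s ⊗ dxⱼ + ∑_{f(i) = j} dtᵢ ⊗ 1`. -/
def hatDX {n m : ℕ} (f : Fin (n + 1) → Fin (m + 1)) (j : Fin (m + 1)) : HatOmega K n m :=
  dx K (0 : Fin (n + 1 + 1)) ᵍ⊗ₜ[K] x K j + x K (0 : Fin (n + 1 + 1)) ᵍ⊗ₜ[K] dx K j +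
    (∑ i with f i = j, dx K i.succ) ᵍ⊗ₜ[K] 1

theorem covec_anticomm {n : ℕ} (v w : Fin (n + 1) → K) :
    covec n v * covec n w = - (covec n w * covec n v) := by
  have h := covec_sq (v + w)
  rw [map_add, mul_add, add_mul, add_mul, covec_sq, covec_sq, zero_add, add_zero] at h
  exact eq_neg_of_add_eq_zero_right h

/-- Anticommutation of two pure tensors, for factors which commute up to sign. -/
theorem tmul_anticomm {n m p q p' q' : ℕ} {a a' : Omega K (n + 1)} {b b' : Omega K m}
    (ha : a ∈ grade K (n + 1) p) (hb : b ∈ grade K m q)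
    (ha' : a' ∈ grade K (n + 1) p') (hb' : b' ∈ grade K m q') {u v : ℤˣ}
    (haa : a * a' = u • (a' * a)) (hbb : b * b' = v • (b' * b))
    (h : (-1 : ℤˣ) ^ (q * p') * (u * v) = - (-1 : ℤˣ) ^ (q' * p)) :
    (a ᵍ⊗ₜ[K] b * a' ᵍ⊗ₜ[K] b' : HatOmega K n m) = - (a' ᵍ⊗ₜ[K] b' * a ᵍ⊗ₜ[K] b) := by
  rw [tmul_mul_tmul_of_mem _ hb ha', tmul_mul_tmul_of_mem _ hb' ha, haa, hbb]
  have e : ∀ (y : Omega K (n + 1)) (z : Omega K m),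
      ((u • y) ᵍ⊗ₜ[K] (v • z) : HatOmega K n m) = (u * v) • (y ᵍ⊗ₜ[K] z) := by
    intro y z
    have e1 : (-y) ⊗ₜ[K] z = - (y ⊗ₜ[K] z) := TensorProduct.neg_tmul _ _
    have e2 : y ⊗ₜ[K] (-z) = - (y ⊗ₜ[K] z) := TensorProduct.tmul_neg _ _
    have e3 : (-y) ⊗ₜ[K] (-z) = y ⊗ₜ[K] z := by
      rw [TensorProduct.tmul_neg, TensorProduct.neg_tmul, neg_neg]
    rcases Int.units_eq_one_or u with rfl | rfl <;> rcases Int.units_eq_one_or v with rfl | rfl <;>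
      simp [GradedTensorProduct.tmul, e1, e2, e3]
  rw [e, smul_smul, h, Units.neg_smul]

theorem hatDX_anticomm {n m : ℕ} (f : Fin (n + 1) → Fin (m + 1)) (i j : Fin (m + 1)) :
    (hatDX f i * hatDX f j : HatOmega K n m) = - (hatDX f j * hatDX f i) := by
  have hs : ∀ j, (∑ i with f i = j, dx K i.succ : Omega K (n + 1)) =
      covec (n + 1) (∑ i with f i = j, (Pi.single i.succ (1 : K) : Fin (n + 1 + 1) → K)) := by
    intro j; rw [map_sum]; rfl
  have hxx : ∀ {l : ℕ} (p q : MvPolynomial (Fin (l + 1)) K),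
      poly l p * poly l q = (1 : ℤˣ) • (poly l q * poly l p) := by
    intro l p q; rw [(poly_commute p _).eq, one_smul]
  have hxd : ∀ {l : ℕ} (p : MvPolynomial (Fin (l + 1)) K) (v : Fin (l + 1) → K),
      poly l p * covec l v = (1 : ℤˣ) • (covec l v * poly l p) := by
    intro l p v; rw [(poly_commute p _).eq, one_smul]
  have hdx : ∀ {l : ℕ} (v : Fin (l + 1) → K) (p : MvPolynomial (Fin (l + 1)) K),
      covec l v * poly l p = (1 : ℤˣ) • (poly l p * covec l v) := by
    intro l v p; rw [(poly_commute p _).eq, one_smul]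
  have hdd : ∀ {l : ℕ} (v w : Fin (l + 1) → K),
      covec l v * covec l w = (-1 : ℤˣ) • (covec l w * covec l v) := by
    intro l v w; rw [covec_anticomm v w, Units.neg_smul, one_smul]
  -- the three kinds of summands
  have hAA := fun (u v u' v') => tmul_anticomm (covec_mem u) (poly_mem v) (covec_mem u')
    (poly_mem v') (hdd (l := n + 1) _ _) (hxx (l := m) _ _) (by decide)
  have hAB := fun (u v u' v') => tmul_anticomm (covec_mem u) (poly_mem v) (poly_mem u')
    (covec_mem v') (hdx (l := n + 1) _ _) (hxd (l := m) _ _) (by decide)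
  have hBB := fun (u v u' v') => tmul_anticomm (poly_mem u) (covec_mem v) (poly_mem u')
    (covec_mem v') (hxx (l := n + 1) _ _) (hdd (l := m) _ _) (by decide)
  have expand : ∀ j, (hatDX f j : HatOmega K n m) =
      covec (n + 1) (Pi.single 0 1) ᵍ⊗ₜ[K] poly m (MvPolynomial.X j) +
      poly (n + 1) (MvPolynomial.X 0) ᵍ⊗ₜ[K] covec m (Pi.single j 1) +
      covec (n + 1) (∑ i with f i = j, (Pi.single i.succ (1 : K) : Fin (n + 1 + 1) → K)) ᵍ⊗ₜ[K]
        poly m 1 := by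
    intro j
    rw [hatDX, hs, map_one (poly (K := K) m), poly_X, poly_X, covec_single, covec_single]
  rw [expand i, expand j]
  generalize (∑ k with f k = i, (Pi.single k.succ (1 : K) : Fin (n + 1 + 1) → K)) = a
  generalize (∑ k with f k = j, (Pi.single k.succ (1 : K) : Fin (n + 1 + 1) → K)) = b
  simp only [mul_add, add_mul]
  rw [hAA (Pi.single 0 1) (MvPolynomial.X i) (Pi.single 0 1) (MvPolynomial.X j),
    hAA (Pi.single 0 1) (MvPolynomial.X i) b 1, hAA a 1 (Pi.single 0 1) (MvPolynomial.X j),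
    hAA a 1 b 1,
    hAB (Pi.single 0 1) (MvPolynomial.X i) (MvPolynomial.X 0) (Pi.single j 1),
    hAB a 1 (MvPolynomial.X 0) (Pi.single j 1),
    hAB (Pi.single 0 1) (MvPolynomial.X j) (MvPolynomial.X 0) (Pi.single i 1),
    hAB b 1 (MvPolynomial.X 0) (Pi.single i 1),
    hBB (MvPolynomial.X 0) (Pi.single i 1) (MvPolynomial.X 0) (Pi.single j 1)]
  abel

theorem hatPoly_tmul {n m : ℕ} (p : MvPolynomial (Fin (n + 1 + 1)) K)
    (q : MvPolynomial (Fin (m + 1)) K) :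
    hatPoly K n m (p ⊗ₜ q) = poly (n + 1) p ᵍ⊗ₜ[K] poly m q := by
  rw [hatPoly, Algebra.TensorProduct.lift_tmul, AlgHom.comp_apply, AlgHom.comp_apply,
    GradedTensorProduct.includeLeft_apply, GradedTensorProduct.includeRight_apply,
    GradedTensorProduct.tmul_one_mul_one_tmul]

theorem hatPoly_commute_tmul {n m i j : ℕ}
    (z : MvPolynomial (Fin (n + 1 + 1)) K ⊗[K] MvPolynomial (Fin (m + 1)) K)
    {a : Omega K (n + 1)} (ha : a ∈ grade K (n + 1) i) {b : Omega K m} (hb : b ∈ grade K m j) :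
    Commute (hatPoly K n m z) (a ᵍ⊗ₜ[K] b) := by
  induction z using TensorProduct.induction_on with
  | zero => rw [map_zero]; exact Commute.zero_left _
  | add y z hy hz => rw [map_add]; exact hy.add_left hz
  | tmul p q =>
    rw [hatPoly_tmul, Commute, SemiconjBy, tmul_mul_tmul_of_mem _ (poly_mem q) ha,
      tmul_mul_tmul_of_mem _ hb (poly_mem p), (poly_commute p a).eq, (poly_commute q b).eq,
      zero_mul, mul_zero]

theorem hatPoly_commute_hatDX {n m : ℕ} (f : Fin (n + 1) → Fin (m + 1)) (j : Fin (m + 1))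
    (z : MvPolynomial (Fin (n + 1 + 1)) K ⊗[K] MvPolynomial (Fin (m + 1)) K) :
    Commute (hatPoly K n m z) (hatDX f j) :=
  ((hatPoly_commute_tmul z (dx_mem _) (x_mem _)).add_right
    (hatPoly_commute_tmul z (x_mem _) (dx_mem _))).add_right
    (hatPoly_commute_tmul z (Submodule.sum_mem _ fun _ _ => dx_mem _) SetLike.GradedOne.one_mem)

/-- The pull-back of polynomials along `((s, t), v) ↦ s v + ∑ᵢ tᵢ e_{f(i)}`. -/
def hatPullPoly {n m : ℕ} (f : Fin (n + 1) → Fin (m + 1)) :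
    MvPolynomial (Fin (m + 1)) K →ₐ[K] HatOmega K n m :=
  (hatPoly K n m).comp (MvPolynomial.aeval (hatX f))

/-- The pull-back of covectors along `((s, t), v) ↦ s v + ∑ᵢ tᵢ e_{f(i)}`. -/
def hatPullCovec {n m : ℕ} (f : Fin (n + 1) → Fin (m + 1)) :
    (Fin (m + 1) → K) →ₗ[K] HatOmega K n m :=
  Fintype.linearCombination K (hatDX f)

theorem hatPullCovec_apply {n m : ℕ} (f : Fin (n + 1) → Fin (m + 1)) (v : Fin (m + 1) → K) :
    hatPullCovec f v = ∑ j, v j • (hatDX f j : HatOmega K n m) := rfl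

theorem hatPullCovec_single {n m : ℕ} (f : Fin (n + 1) → Fin (m + 1)) (j : Fin (m + 1)) :
    hatPullCovec f (Pi.single j (1 : K)) = hatDX f j := by
  rw [hatPullCovec, Fintype.linearCombination_apply_single, one_smul]

theorem hatPullCovec_sq [CharZero K] {n m : ℕ} (f : Fin (n + 1) → Fin (m + 1))
    (v : Fin (m + 1) → K) : hatPullCovec f v * hatPullCovec f v = 0 := by
  have h : hatPullCovec f v * hatPullCovec f v = - (hatPullCovec f v * hatPullCovec f v) := by
    conv_lhs => rw [hatPullCovec_apply, Finset.sum_mul_sum, Finset.sum_comm]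
    rw [hatPullCovec_apply, Finset.sum_mul_sum, ← Finset.sum_neg_distrib]
    refine Finset.sum_congr rfl fun i _ => ?_
    rw [← Finset.sum_neg_distrib]
    refine Finset.sum_congr rfl fun j _ => ?_
    rw [smul_mul_smul_comm, smul_mul_smul_comm, hatDX_anticomm f j i, smul_neg, mul_comm (v j)]
  have h2 : (2 : K) • (hatPullCovec f v * hatPullCovec f v) = 0 := by
    rw [two_smul]
    exact add_eq_zero_iff_eq_neg.2 h
  exact (smul_eq_zero.1 h2).resolve_left two_ne_zero

theorem hatPull_commute {n m : ℕ} (f : Fin (n + 1) → Fin (m + 1))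
    (q : MvPolynomial (Fin (m + 1)) K) (v : Fin (m + 1) → K) :
    Commute (hatPullPoly f q : HatOmega K n m) (hatPullCovec f v) := by
  rw [hatPullCovec_apply, hatPullPoly, AlgHom.comp_apply]
  exact Commute.sum_right _ _ _ fun j _ => (hatPoly_commute_hatDX f j _).smul_right _

theorem tmul_sum_right {n m : ℕ} {ι : Type*} (s : Finset ι) (a : Omega K (n + 1))
    (b : ι → Omega K m) :
    ∑ i ∈ s, (a ᵍ⊗ₜ[K] b i : HatOmega K n m) = a ᵍ⊗ₜ[K] (∑ i ∈ s, b i) := by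
  rw [GradedTensorProduct.tmul, TensorProduct.tmul_sum, map_sum]

theorem tmul_sum_left {n m : ℕ} {ι : Type*} (s : Finset ι) (a : ι → Omega K (n + 1))
    (b : Omega K m) :
    ∑ i ∈ s, (a i ᵍ⊗ₜ[K] b : HatOmega K n m) = (∑ i ∈ s, a i) ᵍ⊗ₜ[K] b := by
  rw [GradedTensorProduct.tmul, TensorProduct.sum_tmul, map_sum]

theorem hatPullPoly_sum {n m : ℕ} (f : Fin (n + 1) → Fin (m + 1)) :
    (hatPullPoly f (∑ j, MvPolynomial.X j : MvPolynomial (Fin (m + 1)) K) : HatOmega K n m) = 1 := by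
  rw [hatPullPoly, AlgHom.comp_apply, map_sum]
  simp only [MvPolynomial.aeval_X, hatX]
  rw [Finset.sum_add_distrib, ← TensorProduct.tmul_sum, ← TensorProduct.sum_tmul,
    Finset.sum_fiberwise, map_add, hatPoly_tmul, hatPoly_tmul, poly_sum, map_one,
    map_sum, ← tmul_sum_left, ← Fin.sum_univ_succ
      (fun i => (poly (n + 1) (MvPolynomial.X i : MvPolynomial (Fin (n + 1 + 1)) K) ᵍ⊗ₜ[K]
        (1 : Omega K m) : HatOmega K n m)), tmul_sum_left, ← map_sum, poly_sum]
  rfl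

theorem hatPullCovec_sum {n m : ℕ} (f : Fin (n + 1) → Fin (m + 1)) :
    ∑ j, (hatPullCovec f (Pi.single j (1 : K)) : HatOmega K n m) = 0 := by
  simp only [hatPullCovec_single, hatDX]
  rw [Finset.sum_add_distrib, Finset.sum_add_distrib, tmul_sum_right, tmul_sum_right,
    tmul_sum_left, Finset.sum_fiberwise]
  have h1 : ∑ j, x K j = (1 : Omega K m) := (map_sum (poly m) _ _).symm.trans poly_sum
  have h2 : ∑ j, dx K j = (0 : Omega K m) := covec_sum
  have h3 : ∑ j, dx K j = (0 : Omega K (n + 1)) := covec_sum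
  have h4 : (x K 0 ᵍ⊗ₜ[K] (0 : Omega K m) : HatOmega K n m) = 0 := by
    rw [GradedTensorProduct.tmul, TensorProduct.tmul_zero, map_zero]
  rw [h1, h2, h4, add_zero, ← tmul_sum_left, ← Fin.sum_univ_succ
    (fun i => (dx K i ᵍ⊗ₜ[K] (1 : Omega K m) : HatOmega K n m)), tmul_sum_left, h3,
    GradedTensorProduct.tmul, TensorProduct.zero_tmul, map_zero]

/-- The pull-back along `f̂ : Δ̂ⁿ × Δᵐ → Δᵐ`, `((s, t₀, …, tₙ), v) ↦ s v + ∑ᵢ tᵢ e_{f(i)}`. -/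
def hatPull [CharZero K] {n m : ℕ} (f : Fin (n + 1) → Fin (m + 1)) :
    Omega K m →ₐ[K] HatOmega K n m :=
  lift (K := K) (n := m) (B := HatOmega K n m) (hatPullPoly f) (hatPullCovec f)
    (hatPullCovec_sq (K := K) f) (hatPull_commute (K := K) f) (hatPullPoly_sum (K := K) f)
    (hatPullCovec_sum (K := K) f)

theorem hatPull_x [CharZero K] {n m : ℕ} (f : Fin (n + 1) → Fin (m + 1)) (j : Fin (m + 1)) :
    (hatPull f (x K j) : HatOmega K n m) =
      x K 0 ᵍ⊗ₜ[K] x K j + (∑ i with f i = j, x K i.succ) ᵍ⊗ₜ[K] 1 := by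
  rw [← poly_X, hatPull, lift_poly, hatPullPoly, AlgHom.comp_apply, MvPolynomial.aeval_X, hatX,
    map_add, hatPoly_tmul, hatPoly_tmul, map_one, map_sum]
  rfl

theorem hatPull_dx [CharZero K] {n m : ℕ} (f : Fin (n + 1) → Fin (m + 1)) (j : Fin (m + 1)) :
    (hatPull f (dx K j) : HatOmega K n m) = hatDX f j := by
  rw [← covec_single, hatPull, lift_covec, hatPullCovec_single]

/-! ### Whitney forms and the operators -/

/-- The Whitney elementary form
`ω_f = n! ∑ᵢ (-1)^i x_{f(i)} dx_{f(0)} ∧ ⋯ ∧ (omit dx_{f(i)}) ∧ ⋯ ∧ dx_{f(n)}`. -/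
def whitney (K : Type*) [Field K] {n m : ℕ} (f : Fin (n + 1) → Fin (m + 1)) : Omega K m :=
  (n.factorial : K) • ∑ i : Fin (n + 1), (-1 : K) ^ (i : ℕ) •
    (x K (f i) * (List.ofFn fun j : Fin n => dx K (f (i.succAbove j))).prod)

/-- The space `Cₘ` of Whitney elementary forms. -/
def whitneySpace (K : Type*) [Field K] (m : ℕ) : Submodule K (Omega K m) :=
  Submodule.span K {ω | ∃ (n : ℕ) (f : Fin (n + 1) →o Fin (m + 1)), ω = whitney K f}

instance (n m : ℕ) : Fintype (Fin (n + 1) ↪o Fin (m + 1)) := Fintype.ofFinite _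

section Operators

variable (K) [CharZero K]

/-- Whitney's map `πₘ(η) = ∑ₙ ∑_{f ∈ I(n, m)} (∫_{Δⁿ} f^*η) ω_f`. -/
def whitneyProj (m : ℕ) : Omega K m →ₗ[K] Omega K m :=
  ∑ n ∈ Finset.range (m + 1), ∑ f : Fin (n + 1) ↪o Fin (m + 1),
    (integral K n ∘ₗ (pullback f).toLinearMap).smulRight (whitney K f)

/-- The operator `k_f = (∫_{Δ̂ⁿ} ⊗ Id) ∘ f̂^*`. -/
def manettiFace {n m : ℕ} (f : Fin (n + 1) → Fin (m + 1)) : Omega K m →ₗ[K] Omega K m :=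
  (TensorProduct.lid K (Omega K m)).toLinearMap ∘ₗ
    (integral K (n + 1)).rTensor (Omega K m) ∘ₗ
    (GradedTensorProduct.of K (grade K (n + 1)) (grade K m)).symm.toLinearMap ∘ₗ
    (hatPull f).toLinearMap

/-- Manetti's operator `kₘ(η) = ∑ₙ ∑_{f ∈ I(n, m)} ω_f ∧ k_f(η)`. -/
def manetti (m : ℕ) : Omega K m →ₗ[K] Omega K m :=
  ∑ n ∈ Finset.range (m + 1), ∑ f : Fin (n + 1) ↪o Fin (m + 1),
    LinearMap.mulLeft K (whitney K f) ∘ₗ manettiFace K f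

end Operators

/-! ### Contractions

All DG-vector spaces that occur are concentrated in nonnegative degrees, so gradings are
indexed by `ℕ`. -/

section Contraction

/-- `(V, 𝒱, d)` is a DG-vector space. -/
structure IsDG {V : Type*} [AddCommGroup V] [Module K V] (𝒱 : ℕ → Submodule K V)
    (d : V →ₗ[K] V) : Prop where
  isInternal : DirectSum.IsInternal 𝒱
  map_mem : ∀ p, ∀ v ∈ 𝒱 p, d v ∈ 𝒱 (p + 1)
  comp_self : d ∘ₗ d = 0

/-- `f` is a morphism of DG-vector spaces. -/
structure IsDGHom {V W : Type*} [AddCommGroup V] [Module K V] [AddCommGroup W] [Module K W]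
    (𝒱 : ℕ → Submodule K V) (dV : V →ₗ[K] V) (𝒲 : ℕ → Submodule K W) (dW : W →ₗ[K] W)
    (f : V →ₗ[K] W) : Prop where
  map_mem : ∀ p, ∀ v ∈ 𝒱 p, f v ∈ 𝒲 p
  comm : f ∘ₗ dV = dW ∘ₗ f

/-- `M ⇄ N` with maps `i : M → N`, `π : N → M` and `h ∈ Hom⁻¹(N, N)` is a contraction. -/
structure IsContraction {M N : Type*} [AddCommGroup M] [Module K M] [AddCommGroup N] [Module K N]
    (𝓜 : ℕ → Submodule K M) (dM : M →ₗ[K] M) (𝓝 : ℕ → Submodule K N) (dN : N →ₗ[K] N)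
    (i : M →ₗ[K] N) (h : N →ₗ[K] N) (π : N →ₗ[K] M) : Prop where
  isDG_left : IsDG 𝓜 dM
  isDG_right : IsDG 𝓝 dN
  isDGHom_i : IsDGHom 𝓜 dM 𝓝 dN i
  isDGHom_π : IsDGHom 𝓝 dN 𝓜 dM π
  h_mem : ∀ p, ∀ v ∈ 𝓝 (p + 1), h v ∈ 𝓝 p
  h_zero : ∀ v ∈ 𝓝 0, h v = 0
  π_comp_i : π ∘ₗ i = LinearMap.id
  homotopy : i ∘ₗ π - LinearMap.id = dN ∘ₗ h + h ∘ₗ dN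

/-- A family of contractions with structure maps `g^*` indexed by the nondecreasing maps
`g : [p] → [m]` is a simplicial object in the category of contractions, in which a morphism
is a morphism `f` of the large DG-vector spaces with `f h = h f`, inducing `π f i` on the
small ones. -/
structure IsSimplicialContraction {M N : ℕ → Type*}
    [∀ m, AddCommGroup (M m)] [∀ m, Module K (M m)]
    [∀ m, AddCommGroup (N m)] [∀ m, Module K (N m)]
    (𝓜 : ∀ m, ℕ → Submodule K (M m)) (dM : ∀ m, M m →ₗ[K] M m)
    (mapM : ∀ {p m : ℕ}, (Fin (p + 1) →o Fin (m + 1)) → M m →ₗ[K] M p)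
    (𝓝 : ∀ m, ℕ → Submodule K (N m)) (dN : ∀ m, N m →ₗ[K] N m)
    (mapN : ∀ {p m : ℕ}, (Fin (p + 1) →o Fin (m + 1)) → N m →ₗ[K] N p)
    (i : ∀ m, M m →ₗ[K] N m) (h : ∀ m, N m →ₗ[K] N m) (π : ∀ m, N m →ₗ[K] M m) : Prop where
  isContraction : ∀ m, IsContraction (𝓜 m) (dM m) (𝓝 m) (dN m) (i m) (h m) (π m)
  map_id : ∀ m, mapN (OrderHom.id : Fin (m + 1) →o Fin (m + 1)) = LinearMap.id
  map_comp : ∀ {q p m : ℕ} (g : Fin (p + 1) →o Fin (m + 1)) (f : Fin (q + 1) →o Fin (p + 1)),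
    mapN (g.comp f) = mapN f ∘ₗ mapN g
  isDGHom_map : ∀ {p m : ℕ} (g : Fin (p + 1) →o Fin (m + 1)),
    IsDGHom (𝓝 m) (dN m) (𝓝 p) (dN p) (mapN g)
  map_h : ∀ {p m : ℕ} (g : Fin (p + 1) →o Fin (m + 1)), mapN g ∘ₗ h m = h p ∘ₗ mapN g
  map_hat : ∀ {p m : ℕ} (g : Fin (p + 1) →o Fin (m + 1)), mapM g = π p ∘ₗ mapN g ∘ₗ i m

end Contraction

end PolyForm

end

/-!
The Stokes formula on `Δ̂ⁿ`, applied to `f̂^* a`, expresses `k_f d a` through `d k_f a`, the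
operators `k_{∂ᵢ f}` of the faces of `f`, and the constant `∫ f^* a` coming from the face `s = 0`.
Summed against the Whitney forms, the face terms telescope with the terms `dω_f ∧ k_f a`, because
`dω_f = ∑ₖ ω_{k,f}`; what is left over is `π a - a`, the `-a` coming from the faces `t₀ = 0` of the
`1`-simplices `Δ̂⁰`. Naturality holds because `k_f g^* = g^* k_{g ∘ f}` and because `k_f = 0` when
`f` is not injective, so that only strictly increasing maps contribute to the sums obtained by
expanding `g^* ω_f = ∑_{g ∘ h = f} ω_h`.
-/

noncomputable section

namespace PolyForm

section ContractionOfProjector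

variable {R V : Type*} [Ring R] [AddCommGroup V] [Module R V] {C : Submodule R V}
  {d π h : V →ₗ[R] V}

theorem comp_comm_of_homotopy (dd : d ∘ₗ d = 0) (homotopy : h ∘ₗ d + d ∘ₗ h = π - LinearMap.id) :
    π ∘ₗ d = d ∘ₗ π := by
  have hπ : π = h ∘ₗ d + d ∘ₗ h + LinearMap.id := by rw [homotopy, sub_add_cancel]
  rw [hπ, LinearMap.add_comp, LinearMap.add_comp, LinearMap.comp_add, LinearMap.comp_add,
    LinearMap.comp_assoc d d h, ← LinearMap.comp_assoc h d d, dd, LinearMap.comp_zero,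
    LinearMap.zero_comp, zero_add, add_zero, LinearMap.comp_assoc]
  rfl

theorem map_mem_of_isProj (hπ : LinearMap.IsProj C π) (comm : π ∘ₗ d = d ∘ₗ π) {v : V}
    (hv : v ∈ C) : d v ∈ C := by
  rw [← hπ.map_id v hv, ← LinearMap.comp_apply, ← comm]
  exact hπ.map_mem _

theorem isInternal_comap_subtype {ι : Type*} [DecidableEq ι] {𝒱 : ι → Submodule R V}
    (h𝒱 : DirectSum.IsInternal 𝒱) (hπ : LinearMap.IsProj C π)
    (π_mem : ∀ p, ∀ v ∈ 𝒱 p, π v ∈ 𝒱 p) :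
    DirectSum.IsInternal fun p => (𝒱 p).comap C.subtype := by
  rw [DirectSum.isInternal_submodule_iff_iSupIndep_and_iSup_eq_top] at h𝒱 ⊢
  refine ⟨fun p => Submodule.disjoint_def.2 fun v hv hv' => Subtype.ext ?_, ?_⟩
  · have le_comap : ⨆ j, ⨆ (_ : j ≠ p), (𝒱 j).comap C.subtype ≤
        (⨆ j, ⨆ (_ : j ≠ p), 𝒱 j).comap C.subtype :=
      iSup₂_le fun j hj => Submodule.comap_mono (le_iSup₂ (f := fun j _ => 𝒱 j) j hj)
    exact Submodule.disjoint_def.1 (h𝒱.1 p) v hv (le_comap hv')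
  · have htop : ⊤ ≤ (⨆ p, (𝒱 p).comap C.subtype).comap (π.codRestrict C hπ.map_mem) :=
      h𝒱.2 ▸ iSup_le fun p v hv => Submodule.mem_iSup_of_mem p (π_mem p v hv)
    refine eq_top_iff.2 fun v _ => ?_
    have hv : π.codRestrict C hπ.map_mem v = v := Subtype.ext (hπ.map_id v v.2)
    exact hv ▸ htop (Submodule.mem_top (x := (v : V)))

theorem isContraction_of_isProj {K V : Type*} [Field K] [AddCommGroup V] [Module K V]
    {C : Submodule K V} {d π h : V →ₗ[K] V} {𝒱 : ℕ → Submodule K V} (hV : IsDG 𝒱 d)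
    (hπ : LinearMap.IsProj C π) (π_mem : ∀ p, ∀ v ∈ 𝒱 p, π v ∈ 𝒱 p)
    (h_mem : ∀ p, ∀ v ∈ 𝒱 (p + 1), h v ∈ 𝒱 p) (h_zero : ∀ v ∈ 𝒱 0, h v = 0)
    (homotopy : h ∘ₗ d + d ∘ₗ h = π - LinearMap.id) (hd : ∀ v ∈ C, d v ∈ C) :
    IsContraction (fun p => (𝒱 p).comap C.subtype) (d.restrict hd) 𝒱 d C.subtype h
      (π.codRestrict C hπ.map_mem) where
  isDG_left :=
    { isInternal := isInternal_comap_subtype hV.isInternal hπ π_mem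
      map_mem := fun p v hv => hV.map_mem p v hv
      comp_self := LinearMap.ext fun v => Subtype.ext (LinearMap.congr_fun hV.comp_self (v : V)) }
  isDG_right := hV
  isDGHom_i := ⟨fun _ _ hv => hv, rfl⟩
  isDGHom_π :=
    { map_mem := π_mem
      comm := LinearMap.ext fun v =>
        Subtype.ext (LinearMap.congr_fun (comp_comm_of_homotopy hV.comp_self homotopy) v) }
  h_mem := h_mem
  h_zero := h_zero
  π_comp_i := LinearMap.ext fun v => Subtype.ext (hπ.map_id v v.2)
  homotopy := by rw [add_comm, homotopy, LinearMap.subtype_comp_codRestrict]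

end ContractionOfProjector

/-! ### Calculus of polynomial forms -/

section Calculus

variable {K : Type*} [Field K] {n m p : ℕ}

theorem mul_mem_grade {i j k : ℕ} {a b : Omega K n} (ha : a ∈ grade K n i)
    (hb : b ∈ grade K n j) (hk : i + j = k) : a * b ∈ grade K n k :=
  hk ▸ SetLike.mul_mem_graded ha hb

variable (K) in
/-- The wedge product of `p` covectors, as a `p`-form with constant coefficients. -/
def wedge (n p : ℕ) : (Fin (n + 1) → K) [⋀^Fin p]→ₗ[K] Omega K n :=
  ((mk K n).toLinearMap ∘ₗ (Algebra.TensorProduct.includeRight (R := K)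
    (A := MvPolynomial (Fin (n + 1)) K)).toLinearMap).compAlternatingMap
      (ExteriorAlgebra.ιMulti K p)

theorem wedge_eq_mk (v : Fin p → Fin (n + 1) → K) :
    wedge K n p v = mk K n (1 ⊗ₜ ExteriorAlgebra.ιMulti K p v) := rfl

theorem wedge_eq_prod (v : Fin p → Fin (n + 1) → K) :
    wedge K n p v = (List.ofFn fun i => covec n (v i)).prod := by
  rw [wedge_eq_mk, ExteriorAlgebra.ιMulti_apply]
  have h := map_list_prod ((mk K n).comp (Algebra.TensorProduct.includeRight (R := K)
    (A := MvPolynomial (Fin (n + 1)) K))) (List.ofFn fun i => ExteriorAlgebra.ι K (v i))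
  rwa [List.map_ofFn] at h

theorem wedge_cons (u : Fin (n + 1) → K) (v : Fin p → Fin (n + 1) → K) :
    wedge K n (p + 1) (Fin.cons u v) = covec n u * wedge K n p v := by
  simp [wedge_eq_prod, List.ofFn_succ]

theorem wedge_mem_grade (v : Fin p → Fin (n + 1) → K) : wedge K n p v ∈ grade K n p :=
  Submodule.subset_span ⟨1, _, ExteriorAlgebra.ιMulti_range K p ⟨v, rfl⟩, rfl⟩

theorem poly_mul_wedge_mem_grade (q : MvPolynomial (Fin (n + 1)) K) (v : Fin p → Fin (n + 1) → K) :
    poly n q * wedge K n p v ∈ grade K n p :=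
  mul_mem_grade (poly_mem q) (wedge_mem_grade v) (zero_add p)

theorem grade_le {S : Submodule K (Omega K n)}
    (h : ∀ (q : MvPolynomial (Fin (n + 1)) K) (v : Fin p → Fin (n + 1) → K),
      poly n q * wedge K n p v ∈ S) : grade K n p ≤ S := by
  refine Submodule.span_le.2 ?_
  rintro _ ⟨q, w, hw, rfl⟩
  rw [SetLike.mem_coe, mk_tmul]
  rw [← ExteriorAlgebra.ιMulti_span_fixedDegree] at hw
  induction hw using Submodule.span_induction with
  | zero => simp
  | add a b _ _ ha hb => simpa only [TensorProduct.tmul_add, map_add, mul_add] using add_mem ha hb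
  | smul c a _ ha =>
    simpa only [TensorProduct.tmul_smul, map_smul, mul_smul_comm] using S.smul_mem c ha
  | mem w hw =>
    obtain ⟨v, rfl⟩ := hw
    exact h q v

theorem linearMap_ext_grade {V : Type*} [AddCommGroup V] [Module K V] {f g : Omega K n →ₗ[K] V}
    (h : ∀ p, ∀ a ∈ grade K n p, f a = g a) : f = g :=
  LinearMap.ext <| DirectSum.Decomposition.inductionOn (grade K n) (by simp)
    (fun a => h _ _ a.2) fun _ _ ha hb => by rw [map_add, map_add, ha, hb]

theorem linearMap_ext_poly_mul_wedge {V : Type*} [AddCommGroup V] [Module K V]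
    {f g : Omega K n →ₗ[K] V}
    (h : ∀ p q v, f (poly n q * wedge K n p v) = g (poly n q * wedge K n p v)) : f = g :=
  linearMap_ext_grade fun p _ ha => grade_le (S := LinearMap.eqLocus f g) (h p) ha

theorem covec_eq_sum (v : Fin (n + 1) → K) : covec n v = ∑ i, v i • dx K i := by
  conv_lhs => rw [pi_eq_sum_univ' v, map_sum]
  simp only [map_smul, ← covec_single]

theorem adjoin_x_union_dx :
    Algebra.adjoin K (Set.range (x K (n := n)) ∪ Set.range (dx K (n := n))) = ⊤ := by
  set S := Algebra.adjoin K (Set.range (x K (n := n)) ∪ Set.range (dx K (n := n)))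
  have x_mem (i) : x K i ∈ S := Algebra.subset_adjoin (Or.inl ⟨i, rfl⟩)
  have dx_mem (i) : dx K i ∈ S := Algebra.subset_adjoin (Or.inr ⟨i, rfl⟩)
  have poly_mem (q) : poly n q ∈ S := by
    induction q using MvPolynomial.induction_on with
    | C r => rw [← MvPolynomial.algebraMap_eq, AlgHom.commutes]; exact S.algebraMap_mem r
    | add a b ha hb => rw [map_add]; exact add_mem ha hb
    | mul_X a i ha => rw [map_mul, poly_X]; exact mul_mem ha (x_mem i)
  have wedge_mem (p) (v : Fin p → Fin (n + 1) → K) : wedge K n p v ∈ S := by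
    rw [wedge_eq_prod]
    refine list_prod_mem fun a ha => ?_
    obtain ⟨i, rfl⟩ := List.mem_ofFn.1 ha
    rw [covec_eq_sum]
    exact sum_mem fun j _ => S.smul_mem (dx_mem j) _
  refine Algebra.eq_top_iff.2 fun a => ?_
  induction a using DirectSum.Decomposition.inductionOn (grade K n) with
  | zero => exact zero_mem S
  | add a b ha hb => exact add_mem ha hb
  | homogeneous a =>
    exact grade_le (S := S.toSubmodule) (fun q v => S.mul_mem (poly_mem q) (wedge_mem _ v)) a.2

theorem left_induction {P : Omega K n → Prop} (one : P 1) (add : ∀ a b, P a → P b → P (a + b))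
    (smul : ∀ (c : K) a, P a → P (c • a)) (x_mul : ∀ i a, P a → P (x K i * a))
    (dx_mul : ∀ i a, P a → P (dx K i * a)) (a : Omega K n) : P a := by
  suffices h : ∀ b, P b → P (a * b) by simpa using h 1 one
  have ha : a ∈ Algebra.adjoin K (Set.range (x K (n := n)) ∪ Set.range (dx K (n := n))) := by
    rw [adjoin_x_union_dx]; exact Algebra.mem_top
  induction ha using Algebra.adjoin_induction with
  | mem a ha =>
    rcases ha with ⟨i, rfl⟩ | ⟨i, rfl⟩
    · exact x_mul i
    · exact dx_mul i
  | algebraMap r => intro b hb; rw [← Algebra.smul_def]; exact smul r b hb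
  | add a a' _ _ ha ha' => intro b hb; rw [add_mul]; exact add _ _ (ha b hb) (ha' b hb)
  | mul a a' _ _ ha ha' => intro b hb; rw [mul_assoc]; exact ha _ (ha' b hb)

theorem linearMap_ext {V : Type*} [AddCommGroup V] [Module K V] {f g : Omega K n →ₗ[K] V}
    (one : f 1 = g 1) (x_mul : ∀ i a, f a = g a → f (x K i * a) = g (x K i * a))
    (dx_mul : ∀ i a, f a = g a → f (dx K i * a) = g (dx K i * a)) : f = g :=
  LinearMap.ext <| left_induction one (fun a b ha hb => by rw [map_add, map_add, ha, hb])
    (fun c a ha => by rw [map_smul, map_smul, ha]) x_mul dx_mul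

theorem freeD_x_mul (i : Fin (n + 1)) (z : Free K n) :
    freeD K n (MvPolynomial.X i ⊗ₜ 1 * z) =
      1 ⊗ₜ ExteriorAlgebra.ι K (Pi.single i 1) * z + MvPolynomial.X i ⊗ₜ 1 * freeD K n z := by
  induction z using TensorProduct.induction_on with
  | zero => simp
  | add a b ha hb => simp only [mul_add, map_add, ha, hb]; abel
  | tmul q w =>
    simp only [Algebra.TensorProduct.tmul_mul_tmul, one_mul, freeD_tmul, Finset.mul_sum,
      Derivation.leibniz, smul_eq_mul, MvPolynomial.pderiv_X, TensorProduct.add_tmul,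
      Finset.sum_add_distrib]
    rw [add_comm]
    congr 1
    rw [Finset.sum_eq_single i (fun j _ hj => by simp [Pi.single_eq_of_ne hj.symm]) (by simp)]
    simp

theorem freeD_ι_mul (v : Fin (n + 1) → K) (z : Free K n) :
    freeD K n (1 ⊗ₜ ExteriorAlgebra.ι K v * z) =
      -(1 ⊗ₜ ExteriorAlgebra.ι K v * freeD K n z) := by
  induction z using TensorProduct.induction_on with
  | zero => simp
  | add a b ha hb => simp only [mul_add, map_add, ha, hb]; abel
  | tmul q w =>
    simp only [Algebra.TensorProduct.tmul_mul_tmul, one_mul, freeD_tmul, Finset.mul_sum,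
      ← Finset.sum_neg_distrib]
    refine Finset.sum_congr rfl fun j _ => ?_
    rw [← TensorProduct.tmul_neg, ← mul_assoc, ← mul_assoc, ← neg_mul]
    congr 2
    exact eq_neg_of_add_eq_zero_left (ExteriorAlgebra.ι_add_mul_swap _ v)

theorem d_one : d K n 1 = 0 := by
  rw [← map_one (mk K n), d_mk, Algebra.TensorProduct.one_def, freeD_tmul]
  simp

theorem d_x_mul (i : Fin (n + 1)) (a : Omega K n) :
    d K n (x K i * a) = dx K i * a + x K i * d K n a := by
  obtain ⟨z, rfl⟩ := mk_surjective n a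
  rw [x, ← map_mul, d_mk, freeD_x_mul, map_add, map_mul, map_mul, d_mk]
  rfl

theorem d_dx_mul (i : Fin (n + 1)) (a : Omega K n) :
    d K n (dx K i * a) = -(dx K i * d K n a) := by
  obtain ⟨z, rfl⟩ := mk_surjective n a
  rw [dx, ← map_mul, d_mk, freeD_ι_mul, map_neg, map_mul, d_mk]

theorem d_x (i : Fin (n + 1)) : d K n (x K i) = dx K i := by
  rw [← mul_one (x K i), d_x_mul, d_one, mul_zero, add_zero, mul_one]

theorem d_dx (i : Fin (n + 1)) : d K n (dx K i) = 0 := by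
  rw [← mul_one (dx K i), d_dx_mul, d_one, mul_zero, neg_zero]

theorem d_comp_d (n : ℕ) : d K n ∘ₗ d K n = 0 := by
  refine linearMap_ext ?_ (fun i a h => ?_) fun i a h => ?_ <;>
    simp only [LinearMap.comp_apply, LinearMap.zero_apply] at *
  · rw [d_one, map_zero]
  · rw [d_x_mul, map_add, d_x_mul, d_dx_mul, h, mul_zero, add_zero, neg_add_cancel]
  · rw [d_dx_mul, map_neg, d_dx_mul, h, mul_zero, neg_zero, neg_zero]

theorem d_poly_mul_wedge (q : MvPolynomial (Fin (n + 1)) K) (v : Fin p → Fin (n + 1) → K) :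
    d K n (poly n q * wedge K n p v) =
      ∑ i, poly n (MvPolynomial.pderiv i q) * wedge K n (p + 1) (Fin.cons (Pi.single i 1) v) := by
  rw [wedge_eq_mk, ← mk_tmul, d_mk, freeD_tmul, map_sum]
  refine Finset.sum_congr rfl fun i _ => ?_
  rw [mk_tmul, wedge_cons, mk_one_tmul_ι_mul]
  rfl

theorem d_mem_grade {a : Omega K n} (ha : a ∈ grade K n p) : d K n a ∈ grade K n (p + 1) := by
  refine grade_le (S := (grade K n (p + 1)).comap (d K n)) (fun q v => ?_) ha
  rw [Submodule.mem_comap, d_poly_mul_wedge]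
  exact sum_mem fun i _ => poly_mul_wedge_mem_grade _ _

theorem isDG_grade (n : ℕ) : IsDG (grade K n) (d K n) where
  isInternal := DirectSum.Decomposition.isInternal (grade K n)
  map_mem _ _ := d_mem_grade
  comp_self := d_comp_d n

theorem algHom_mem_of_mem_grade {B : Type*} [Ring B] [Algebra K B] {𝓑 : ℕ → Submodule K B}
    [SetLike.GradedMonoid 𝓑] {F : Omega K n →ₐ[K] B} (hx : ∀ i, F (x K i) ∈ 𝓑 0)
    (hdx : ∀ i, F (dx K i) ∈ 𝓑 1) {a : Omega K n} (ha : a ∈ grade K n p) : F a ∈ 𝓑 p := by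
  have poly_mem (q) : F (poly n q) ∈ 𝓑 0 := by
    induction q using MvPolynomial.induction_on with
    | C r =>
      rw [← MvPolynomial.algebraMap_eq, AlgHom.commutes, AlgHom.commutes,
        Algebra.algebraMap_eq_smul_one]
      exact Submodule.smul_mem _ _ SetLike.GradedOne.one_mem
    | add a b ha hb => rw [map_add, map_add]; exact add_mem ha hb
    | mul_X a i ha => rw [map_mul, map_mul, poly_X]; exact SetLike.mul_mem_graded ha (hx i)
  have wedge_mem (v : Fin p → Fin (n + 1) → K) : F (wedge K n p v) ∈ 𝓑 p := by
    rw [wedge_eq_prod, map_list_prod, List.map_ofFn]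
    convert SetLike.list_prod_ofFn_mem_graded (A := 𝓑) (fun _ : Fin p => 1) _ fun i => ?_
    · simp
    · rw [Function.comp_apply, covec_eq_sum, map_sum]
      exact sum_mem fun j _ => by rw [map_smul]; exact Submodule.smul_mem _ _ (hdx j)
  refine grade_le (S := (𝓑 p).comap F.toLinearMap) (fun q v => ?_) ha
  rw [Submodule.mem_comap, AlgHom.toLinearMap_apply, map_mul]
  simpa only [zero_add] using SetLike.mul_mem_graded (poly_mem q) (wedge_mem v)

theorem comp_d_eq_of_skewDerivation {B : Type*} [Ring B] [Algebra K B] {F : Omega K n →ₐ[K] B}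
    {D : B →ₗ[K] B} {σ : B → B} (leibniz : ∀ a b, D (a * b) = D a * b + σ a * D b)
    (D_one : D 1 = 0)
    (D_x : ∀ i, D (F (x K i)) = F (dx K i)) (D_dx : ∀ i, D (F (dx K i)) = 0)
    (σ_x : ∀ i, σ (F (x K i)) = F (x K i)) (σ_dx : ∀ i, σ (F (dx K i)) = -F (dx K i)) :
    F.toLinearMap ∘ₗ d K n = D ∘ₗ F.toLinearMap := by
  refine linearMap_ext ?_ (fun i a h => ?_) fun i a h => ?_ <;>
    simp only [LinearMap.comp_apply, AlgHom.toLinearMap_apply] at *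
  · rw [d_one, map_zero, map_one, D_one]
  · rw [d_x_mul, map_add, map_mul, map_mul, map_mul, leibniz, D_x, σ_x, h]
  · rw [d_dx_mul, map_neg, map_mul, map_mul, leibniz, D_dx, σ_dx, h, zero_mul, zero_add, neg_mul]

variable (K) in
/-- The grading involution, which is `(-1) ^ p` on `p`-forms. It carries the Koszul signs. -/
def invol (n : ℕ) : Omega K n →ₐ[K] Omega K n :=
  lift (K := K) (n := n) (B := Omega K n) (poly n) (-covec n)
    (fun v => by simp [covec_sq]) (fun q v => poly_commute q _) poly_sum
    (by simp [covec_sum])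

theorem invol_x (i : Fin (n + 1)) : invol K n (x K i) = x K i := by
  rw [← poly_X, invol, lift_poly]

theorem invol_dx (i : Fin (n + 1)) : invol K n (dx K i) = -dx K i := by
  rw [← covec_single, invol, lift_covec, LinearMap.neg_apply]

theorem invol_poly_mul_wedge (q : MvPolynomial (Fin (n + 1)) K) (v : Fin p → Fin (n + 1) → K) :
    invol K n (poly n q * wedge K n p v) = (-1 : K) ^ p • (poly n q * wedge K n p v) := by
  have hneg : invol K n (wedge K n p v) = wedge K n p fun i => (-1 : K) • v i := by
    simp only [wedge_eq_prod, map_list_prod, List.map_ofFn, Function.comp_def, invol, lift_covec,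
      neg_one_smul, map_neg, LinearMap.neg_apply]
  have hsmul := (wedge K n p).toMultilinearMap.map_smul_univ (fun _ => (-1 : K)) v
  rw [Finset.prod_const, Finset.card_univ, Fintype.card_fin] at hsmul
  rw [map_mul, hneg, ← mul_smul_comm]
  exact congrArg₂ (· * ·) (by rw [invol, lift_poly]) hsmul

theorem invol_of_mem_grade {a : Omega K n} (ha : a ∈ grade K n p) :
    invol K n a = (-1 : K) ^ p • a :=
  (grade_le (S := LinearMap.eqLocus (invol K n).toLinearMap ((-1 : K) ^ p • LinearMap.id))
    invol_poly_mul_wedge ha :)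

theorem d_mul (a b : Omega K n) : d K n (a * b) = d K n a * b + invol K n a * d K n b := by
  suffices h : d K n ∘ₗ LinearMap.mulRight K b = LinearMap.mulRight K b ∘ₗ d K n +
      LinearMap.mulRight K (d K n b) ∘ₗ (invol K n).toLinearMap from LinearMap.congr_fun h a
  refine linearMap_ext ?_ (fun i a h => ?_) fun i a h => ?_ <;>
    simp only [LinearMap.comp_apply, LinearMap.add_apply, LinearMap.mulRight_apply,
      AlgHom.toLinearMap_apply] at *
  · rw [d_one, map_one, one_mul, one_mul, zero_mul, zero_add]
  · rw [mul_assoc, d_x_mul, h, d_x_mul, map_mul, invol_x, mul_add, add_mul]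
    simp only [mul_assoc, add_assoc]
  · rw [mul_assoc, d_dx_mul, h, d_dx_mul, map_mul, invol_dx, mul_add, neg_add]
    simp only [mul_assoc, neg_mul]

theorem pullback_id : pullback (K := K) (id : Fin (n + 1) → Fin (n + 1)) = AlgHom.id K _ :=
  algHom_ext (fun i => by simp [pullback_x, Finset.filter_eq'])
    (fun i => by simp [pullback_dx, Finset.filter_eq'])

theorem sum_filter_comp {α β γ V : Type*} [Fintype α] [Fintype β] [DecidableEq β] [DecidableEq γ]
    [AddCommMonoid V] (f : β → γ) (c : α → β) (u : α → V) (j : γ) :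
    ∑ i with (f ∘ c) i = j, u i = ∑ k with f k = j, ∑ i with c i = k, u i := by
  rw [← Finset.sum_fiberwise_of_maps_to (s := Finset.univ.filter fun i => (f ∘ c) i = j)
    (t := Finset.univ.filter fun k => f k = j) (g := c) (by simp)]
  refine Finset.sum_congr rfl fun k hk => Finset.sum_congr ?_ fun _ _ => rfl
  ext i
  simp only [Finset.mem_filter, Finset.mem_univ, true_and, Function.comp_apply] at hk ⊢
  exact ⟨fun h => h.2, fun h => ⟨by rw [h, hk], h⟩⟩

theorem pullback_comp {l : ℕ} (g : Fin (n + 1) → Fin (m + 1)) (f : Fin (l + 1) → Fin (n + 1)) :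
    pullback (K := K) (g ∘ f) = (pullback f).comp (pullback g) := by
  refine algHom_ext (fun j => ?_) (fun j => ?_)
  · simp only [AlgHom.comp_apply, pullback_x, map_sum, sum_filter_comp g f]
  · simp only [AlgHom.comp_apply, pullback_dx, map_sum, sum_filter_comp g f]

theorem pullback_comp_d (g : Fin (n + 1) → Fin (m + 1)) :
    (pullback (K := K) g).toLinearMap ∘ₗ d K m = d K n ∘ₗ (pullback g).toLinearMap :=
  comp_d_eq_of_skewDerivation d_mul d_one
    (fun i => by simp only [pullback_x, pullback_dx, map_sum, d_x])
    (fun i => by simp only [pullback_dx, map_sum, d_dx, Finset.sum_const_zero])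
    (fun i => by simp only [pullback_x, map_sum, invol_x])
    (fun i => by simp only [pullback_dx, map_sum, invol_dx, Finset.sum_neg_distrib])

theorem pullback_mem_grade (g : Fin (n + 1) → Fin (m + 1)) {a : Omega K m}
    (ha : a ∈ grade K m p) : pullback g a ∈ grade K n p :=
  algHom_mem_of_mem_grade (fun i => by rw [pullback_x]; exact sum_mem fun j _ => x_mem j)
    (fun i => by rw [pullback_dx]; exact sum_mem fun j _ => dx_mem j) ha

theorem pullback_covec (g : Fin (n + 1) → Fin (m + 1)) (v : Fin (m + 1) → K) :
    pullback g (covec m v) = covec n (v ∘ g) := by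
  rw [pullback, lift_covec]; rfl

theorem pullback_wedge (g : Fin (n + 1) → Fin (m + 1)) (v : Fin p → Fin (m + 1) → K) :
    pullback g (wedge K m p v) = wedge K n p fun i => v i ∘ g := by
  simp only [wedge_eq_prod, map_list_prod, List.map_ofFn, Function.comp_def, pullback_covec]

theorem pullback_poly (g : Fin (n + 1) → Fin (m + 1)) (q : MvPolynomial (Fin (m + 1)) K) :
    pullback g (poly m q) =
      poly n (MvPolynomial.aeval (fun j => ∑ i with g i = j, MvPolynomial.X i) q) := by
  rw [pullback, lift_poly]; rfl

end Calculus

/-! ### Integration and the Stokes formula -/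

section Integration

variable {K : Type*} [Field K] {n m p : ℕ}

variable (K) in
/-- The functional `x^k ↦ ∏ kᵢ! / (∑ kᵢ + r)!` on polynomials. For `n + 1` variables and `r = n`
it is `moment K n`; `r = n - 1` occurs in the comparison of a simplex with its facets. -/
def dirichletMoment (σ : Type*) [Fintype σ] (r : ℕ) : MvPolynomial σ K →ₗ[K] K :=
  (MvPolynomial.basisMonomials σ K).constr K fun k =>
    ((∏ i, (k i).factorial : ℕ) : K) / (((∑ i, k i) + r).factorial : K)

theorem dirichletMoment_monomial {σ : Type*} [Fintype σ] (r : ℕ) (k : σ →₀ ℕ) :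
    dirichletMoment K σ r (MvPolynomial.monomial k 1) =
      ((∏ i, (k i).factorial : ℕ) : K) / (((∑ i, k i) + r).factorial : K) :=
  (MvPolynomial.basisMonomials σ K).constr_basis K _ k

theorem dirichletMoment_pderiv_monomial {σ : Type*} [Fintype σ] (r : ℕ) (k : σ →₀ ℕ) (i : σ) :
    dirichletMoment K σ (r + 1)
        (MvPolynomial.pderiv i (MvPolynomial.monomial (k + Finsupp.single i 1) 1)) =
      dirichletMoment K σ r (MvPolynomial.monomial (k + Finsupp.single i 1) 1) := by
  classical
  have hprod : ∏ j, ((k + Finsupp.single i 1 : σ →₀ ℕ) j).factorial =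
      (k i + 1) * ∏ j, (k j).factorial := by
    rw [Fintype.prod_eq_mul_prod_compl i, Fintype.prod_eq_mul_prod_compl i fun j => (k j).factorial,
      ← mul_assoc, ← Nat.factorial_succ]
    refine congrArg₂ _ (by simp) (Finset.prod_congr rfl fun j hj => ?_)
    simp [show j ≠ i by simpa using hj]
  have hsum : ∑ j, (k + Finsupp.single i 1 : σ →₀ ℕ) j = ∑ j, k j + 1 := by
    simp [Finset.sum_add_distrib, Finsupp.single_apply]
  have hsmul : MvPolynomial.monomial k ((k i : K) + 1) =
      ((k i : K) + 1) • MvPolynomial.monomial k 1 := by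
    rw [MvPolynomial.smul_monomial, smul_eq_mul, mul_one]
  rw [MvPolynomial.pderiv_monomial, add_tsub_cancel_right, Finsupp.add_apply,
    Finsupp.single_eq_same, one_mul, Nat.cast_add, Nat.cast_one, hsmul, map_smul,
    dirichletMoment_monomial, dirichletMoment_monomial, hprod, hsum, add_right_comm (∑ j, k j),
    add_assoc (∑ j, k j), smul_eq_mul, Nat.cast_mul, Nat.cast_add, Nat.cast_one, mul_div_assoc]

theorem aeval_facet_monomial_of_eq_zero {k : Fin (n + 1 + 1) →₀ ℕ} {i : Fin (n + 1 + 1)}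
    (hk : k i = 0) :
    MvPolynomial.aeval (fun j => ∑ l with i.succAbove l = j, (MvPolynomial.X l : MvPolynomial _ K))
        (MvPolynomial.monomial k (1 : K)) =
      MvPolynomial.monomial (Finsupp.equivFunOnFinite.symm fun j => k (i.succAbove j)) 1 := by
  rw [MvPolynomial.aeval_monomial, map_one, one_mul, Finsupp.prod_fintype _ _ (by simp),
    Fin.prod_univ_succAbove _ i, hk, pow_zero, one_mul, MvPolynomial.monomial_eq,
    Finsupp.prod_fintype _ _ (by simp), map_one, one_mul]
  simp [Finset.filter_eq']

theorem aeval_facet_monomial_of_ne_zero {k : Fin (n + 1 + 1) →₀ ℕ} {i : Fin (n + 1 + 1)}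
    (hk : k i ≠ 0) :
    MvPolynomial.aeval (fun j => ∑ l with i.succAbove l = j, (MvPolynomial.X l : MvPolynomial _ K))
      (MvPolynomial.monomial k (1 : K)) = 0 := by
  rw [MvPolynomial.aeval_monomial, Finsupp.prod_fintype _ _ (by simp), Fin.prod_univ_succAbove _ i]
  simp [Fin.succAbove_ne, hk]

theorem dirichletMoment_pderiv_add_facet (r : ℕ) (i : Fin (n + 1 + 1))
    (q : MvPolynomial (Fin (n + 1 + 1)) K) :
    dirichletMoment K _ (r + 1) (MvPolynomial.pderiv i q) + dirichletMoment K (Fin (n + 1)) r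
        (MvPolynomial.aeval (fun j => ∑ l with i.succAbove l = j, MvPolynomial.X l) q) =
      dirichletMoment K _ r q := by
  suffices h : dirichletMoment K _ (r + 1) ∘ₗ (MvPolynomial.pderiv i).toLinearMap +
      dirichletMoment K (Fin (n + 1)) r ∘ₗ (MvPolynomial.aeval
        (fun j => ∑ l with i.succAbove l = j, MvPolynomial.X l)).toLinearMap =
      dirichletMoment K _ r from LinearMap.congr_fun h q
  refine (MvPolynomial.basisMonomials (Fin (n + 1 + 1)) K).ext fun k => ?_
  simp only [MvPolynomial.coe_basisMonomials, LinearMap.add_apply, LinearMap.comp_apply,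
    AlgHom.toLinearMap_apply, Derivation.coeFn_coe]
  by_cases hk : k i = 0
  · rw [aeval_facet_monomial_of_eq_zero hk, dirichletMoment_monomial, dirichletMoment_monomial,
      Fin.prod_univ_succAbove (fun j => (k j).factorial) i, Fin.sum_univ_succAbove k i]
    simp [hk]
  · obtain ⟨k, rfl⟩ : ∃ k', k = k' + Finsupp.single i 1 :=
      ⟨k - Finsupp.single i 1, (tsub_add_cancel_of_le (by simpa [Nat.one_le_iff_ne_zero])).symm⟩
    rw [aeval_facet_monomial_of_ne_zero hk, map_zero, add_zero, dirichletMoment_pderiv_monomial]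

/-- The determinant which orients the `n`-simplex: `v₁ ∧ ⋯ ∧ vₙ` is the constant multiple
`simplexDet v` of `dx₁ ∧ ⋯ ∧ dxₙ`. The first row of ones stands for the relation `∑ dxᵢ = 0`. -/
def simplexDet (v : Fin n → Fin (n + 1) → K) : K :=
  Matrix.det (Matrix.of (Fin.cons 1 v))

theorem ιMulti_cons {R V : Type*} [CommRing R] [AddCommGroup V] [Module R V] (u : V)
    (v : Fin p → V) :
    ExteriorAlgebra.ιMulti R (p + 1) (Fin.cons u v) =
      ExteriorAlgebra.ι R u * ExteriorAlgebra.ιMulti R p v := by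
  rw [ExteriorAlgebra.ιMulti_apply, ExteriorAlgebra.ιMulti_apply, List.ofFn_succ]; simp

theorem orient_ιMulti (v : Fin n → Fin (n + 1) → K) :
    orient K n (ExteriorAlgebra.ιMulti K n v) = simplexDet v := by
  rw [orient, LinearMap.comp_apply, LinearMap.mulLeft_apply, ← map_sum, topCoeff,
    show ∑ i, Pi.single i (1 : K) = (1 : Fin (n + 1) → K) from Finset.univ_sum_single 1,
    ← ιMulti_cons, ExteriorAlgebra.liftAlternating_apply_ιMulti, Pi.single_eq_same]
  rfl

theorem simplexDet_cons_single (i : Fin (n + 1 + 1)) (v : Fin n → Fin (n + 1 + 1) → K) :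
    simplexDet (Fin.cons (Pi.single i 1) v) =
      -((-1) ^ (i : ℕ) * simplexDet fun j => v j ∘ i.succAbove) := by
  have hrow (j) : Matrix.of (Fin.cons 1 (Fin.cons (Pi.single i 1) v) :
      Fin (n + 1 + 1) → Fin (n + 1 + 1) → K) 1 j = Pi.single (M := fun _ => K) i 1 j := by
    rw [← Fin.succ_zero_eq_one]; rfl
  have hminor : (Matrix.of (Fin.cons 1 (Fin.cons (Pi.single i 1) v) :
      Fin (n + 1 + 1) → Fin (n + 1 + 1) → K)).submatrix (Fin.succAbove 1) i.succAbove =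
      Matrix.of (Fin.cons 1 fun j => v j ∘ i.succAbove : Fin (n + 1) → Fin (n + 1) → K) := by
    ext a b
    refine Fin.cases ?_ (fun a => ?_) a
    · simp
    · rw [Matrix.submatrix_apply, ← Fin.succ_zero_eq_one, Fin.succ_succAbove_succ]
      simp
  rw [simplexDet, simplexDet, Matrix.det_succ_row _ 1,
    Finset.sum_eq_single i (fun j _ hj => by rw [hrow, Pi.single_eq_of_ne hj]; simp) (by simp),
    hrow, hminor, Pi.single_eq_same, pow_add]
  simp

theorem sum_simplexDet_cons_single (v : Fin n → Fin (n + 1 + 1) → K) :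
    ∑ i, simplexDet (Fin.cons (Pi.single i 1) v) = 0 := by
  simp only [← orient_ιMulti, ιMulti_cons]
  rw [← map_sum, ← Finset.sum_mul, orient, LinearMap.comp_apply, LinearMap.mulLeft_apply,
    ← map_sum, ← mul_assoc, ExteriorAlgebra.ι_sq_zero, zero_mul, map_zero]

theorem simplexDet_comp_of_not_injective {g : Fin (n + 1) → Fin (m + 1)}
    (hg : ¬ Function.Injective g) (v : Fin n → Fin (m + 1) → K) :
    simplexDet (fun i => v i ∘ g) = 0 := by
  obtain ⟨i, j, hij, hne⟩ := Function.not_injective_iff.1 hg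
  refine Matrix.det_zero_of_column_eq hne fun k => ?_
  refine Fin.cases (by simp) (fun k => ?_) k
  simp [hij]

variable [CharZero K]

theorem integral_poly_mul_wedge (q : MvPolynomial (Fin (n + 1)) K) (v : Fin n → Fin (n + 1) → K) :
    integral K n (poly n q * wedge K n n v) = dirichletMoment K _ n q * simplexDet v := by
  rw [wedge_eq_mk, ← mk_tmul, integral_mk, freeIntegral_tmul, orient_ιMulti]
  rfl

theorem integral_invol (a : Omega K n) :
    integral K n (invol K n a) = (-1) ^ n * integral K n a := by
  suffices h : integral K n ∘ₗ (invol K n).toLinearMap = (-1 : K) ^ n • integral K n from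
    LinearMap.congr_fun h a
  refine linearMap_ext_grade fun p a ha => ?_
  rw [LinearMap.comp_apply, AlgHom.toLinearMap_apply, invol_of_mem_grade ha, map_smul,
    LinearMap.smul_apply]
  by_cases hp : p = n
  · rw [hp]
  · rw [integral_of_ne hp ha, smul_zero, smul_zero]

theorem integral_pullback_of_not_injective {g : Fin (n + 1) → Fin (m + 1)}
    (hg : ¬ Function.Injective g) : integral K n ∘ₗ (pullback (K := K) g).toLinearMap = 0 := by
  refine linearMap_ext_poly_mul_wedge fun p q v => ?_
  rw [LinearMap.comp_apply, AlgHom.toLinearMap_apply, LinearMap.zero_apply]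
  by_cases hp : p = n
  · subst hp
    rw [map_mul, pullback_poly, pullback_wedge, integral_poly_mul_wedge,
      simplexDet_comp_of_not_injective hg, mul_zero]
  · exact integral_of_ne hp (pullback_mem_grade g (poly_mul_wedge_mem_grade q v))

theorem integral_comp_d (n : ℕ) :
    integral K (n + 1) ∘ₗ d K (n + 1) =
      ∑ i : Fin (n + 1 + 1), (-1 : K) ^ (i : ℕ) •
        (integral K n ∘ₗ (pullback (K := K) i.succAbove).toLinearMap) := by
  refine linearMap_ext_poly_mul_wedge fun p q v => ?_
  simp only [LinearMap.comp_apply, LinearMap.sum_apply, LinearMap.smul_apply,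
    AlgHom.toLinearMap_apply]
  by_cases hp : p = n
  · subst hp
    have integral_facet (i : Fin (p + 1 + 1)) :
        (-1 : K) ^ (i : ℕ) • integral K p (pullback i.succAbove (poly (p + 1) q * wedge K _ p v)) =
          dirichletMoment K _ (p + 1) (MvPolynomial.pderiv i q) *
              simplexDet (Fin.cons (Pi.single i 1) v) -
            dirichletMoment K _ p q * simplexDet (Fin.cons (Pi.single i 1) v) := by
      rw [map_mul, pullback_poly, pullback_wedge, integral_poly_mul_wedge, simplexDet_cons_single,
        ← dirichletMoment_pderiv_add_facet p i q, smul_eq_mul]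
      ring
    simp only [integral_facet, d_poly_mul_wedge, map_sum, integral_poly_mul_wedge]
    rw [Finset.sum_sub_distrib, ← Finset.mul_sum, sum_simplexDet_cons_single, mul_zero, sub_zero]
  · have hdeg := poly_mul_wedge_mem_grade q v
    rw [integral_of_ne (by omega) (d_mem_grade hdeg), Finset.sum_eq_zero fun i _ => by
      rw [integral_of_ne hp (pullback_mem_grade _ hdeg), smul_zero]]

end Integration

/-! ### Graded tensor products -/

section GradedTensor

variable {R A B A' B' : Type*} [CommRing R] [Ring A] [Algebra R A] [Ring B] [Algebra R B]
  [Ring A'] [Algebra R A'] [Ring B'] [Algebra R B']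
  {𝒜 : ℕ → Submodule R A} {ℬ : ℕ → Submodule R B} [GradedAlgebra 𝒜] [GradedAlgebra ℬ]
  {𝒜' : ℕ → Submodule R A'} {ℬ' : ℕ → Submodule R B'} [GradedAlgebra 𝒜'] [GradedAlgebra ℬ']

theorem gradedTensor_induction {P : 𝒜 ᵍ⊗[R] ℬ → Prop} (z : 𝒜 ᵍ⊗[R] ℬ) (zero : P 0)
    (add : ∀ y z, P y → P z → P (y + z))
    (tmul : ∀ i j, ∀ a ∈ 𝒜 i, ∀ b ∈ ℬ j, P (a ᵍ⊗ₜ[R] b)) : P z := by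
  induction z using TensorProduct.induction_on with
  | zero => exact zero
  | add y z hy hz => exact add y z hy hz
  | tmul a b =>
    induction a using DirectSum.Decomposition.inductionOn 𝒜 with
    | zero => rw [TensorProduct.zero_tmul]; exact zero
    | add a a' ha ha' => rw [TensorProduct.add_tmul]; exact add _ _ ha ha'
    | homogeneous a =>
      induction b using DirectSum.Decomposition.inductionOn ℬ with
      | zero => rw [TensorProduct.tmul_zero]; exact zero
      | add b b' hb hb' => rw [TensorProduct.tmul_add]; exact add _ _ hb hb'
      | homogeneous b => exact tmul _ _ a a.2 b b.2

theorem gradedTmul_mul_gradedTmul {i j : ℕ} (a : A) {b : B} (hb : b ∈ ℬ j) {a' : A}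
    (ha' : a' ∈ 𝒜 i) (b' : B) :
    (a ᵍ⊗ₜ[R] b * a' ᵍ⊗ₜ[R] b' : 𝒜 ᵍ⊗[R] ℬ) = (-1 : R) ^ (j * i) • (a * a') ᵍ⊗ₜ[R] (b * b') := by
  rw [GradedTensorProduct.tmul_coe_mul_coe_tmul 𝒜 ℬ a ⟨b, hb⟩ ⟨a', ha'⟩ b']
  rcases Nat.even_or_odd (j * i) with h | h
  · simp [h.neg_one_pow]
  · simp [h.neg_one_pow]

variable (𝒜 ℬ) in
/-- The part of total degree `p` of a graded tensor product. -/
def totalGrade (p : ℕ) : Submodule R (𝒜 ᵍ⊗[R] ℬ) :=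
  Submodule.span R {z | ∃ r s, ∃ a ∈ 𝒜 r, ∃ b ∈ ℬ s, r + s = p ∧ a ᵍ⊗ₜ[R] b = z}

theorem gradedTmul_mem_totalGrade {i j k : ℕ} {a : A} {b : B} (ha : a ∈ 𝒜 i) (hb : b ∈ ℬ j)
    (hk : i + j = k) : a ᵍ⊗ₜ[R] b ∈ totalGrade 𝒜 ℬ k :=
  Submodule.subset_span ⟨i, j, a, ha, b, hb, hk, rfl⟩

instance : SetLike.GradedMonoid (totalGrade 𝒜 ℬ) where
  one_mem := gradedTmul_mem_totalGrade SetLike.GradedOne.one_mem SetLike.GradedOne.one_mem rfl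
  mul_mem i j y z hy hz := by
    induction hy, hz using Submodule.span_induction₂ with
    | zero_left | zero_right => simp
    | add_left _ _ _ _ _ _ h h' => rw [add_mul]; exact add_mem h h'
    | add_right _ _ _ _ _ _ h h' => rw [mul_add]; exact add_mem h h'
    | smul_left _ _ _ _ _ h => rw [smul_mul_assoc]; exact Submodule.smul_mem _ _ h
    | smul_right _ _ _ _ _ h => rw [mul_smul_comm]; exact Submodule.smul_mem _ _ h
    | mem_mem y z hy hz =>
      obtain ⟨r, s, a, ha, b, hb, hrs, rfl⟩ := hy
      obtain ⟨r', s', a', ha', b', hb', hrs', rfl⟩ := hz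
      rw [gradedTmul_mul_gradedTmul a hb ha' b']
      exact Submodule.smul_mem _ _ (gradedTmul_mem_totalGrade (SetLike.mul_mem_graded ha ha')
        (SetLike.mul_mem_graded hb hb') (by omega))

/-- The algebra morphism `φ ⊗ ψ` between graded tensor products induced by degree-preserving
algebra morphisms `φ` and `ψ`. -/
def gradedMap (φ : A →ₐ[R] A') (ψ : B →ₐ[R] B') (hφ : ∀ i, ∀ a ∈ 𝒜 i, φ a ∈ 𝒜' i)
    (hψ : ∀ j, ∀ b ∈ ℬ j, ψ b ∈ ℬ' j) : 𝒜 ᵍ⊗[R] ℬ →ₐ[R] 𝒜' ᵍ⊗[R] ℬ' :=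
  GradedTensorProduct.lift 𝒜 ℬ ((GradedTensorProduct.includeLeft 𝒜' ℬ').comp φ)
    ((GradedTensorProduct.includeRight 𝒜' ℬ').comp ψ) fun i j a b => by
      change (φ a ᵍ⊗ₜ[R] 1 * 1 ᵍ⊗ₜ[R] ψ b : 𝒜' ᵍ⊗[R] ℬ') =
        (-1 : ℤˣ) ^ (j * i) • (1 ᵍ⊗ₜ[R] ψ b * φ a ᵍ⊗ₜ[R] 1 : 𝒜' ᵍ⊗[R] ℬ')
      rw [GradedTensorProduct.tmul_one_mul_one_tmul,
        GradedTensorProduct.tmul_coe_mul_coe_tmul 𝒜' ℬ' 1 ⟨_, hψ j b b.2⟩ ⟨_, hφ i a a.2⟩ 1,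
        smul_smul, Int.units_mul_self, one_smul, one_mul, mul_one]

theorem gradedMap_tmul (φ : A →ₐ[R] A') (ψ : B →ₐ[R] B') (hφ : ∀ i, ∀ a ∈ 𝒜 i, φ a ∈ 𝒜' i)
    (hψ : ∀ j, ∀ b ∈ ℬ j, ψ b ∈ ℬ' j) (a : A) (b : B) :
    gradedMap φ ψ hφ hψ (a ᵍ⊗ₜ[R] b) = φ a ᵍ⊗ₜ[R] ψ b :=
  GradedTensorProduct.tmul_one_mul_one_tmul 𝒜' ℬ' (φ a) (ψ b)

end GradedTensor

/-! ### Forms on a product of simplices -/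

section ProdForm

variable {K : Type*} [Field K] {n n' m m' p : ℕ}

variable (K) in
/-- Forms on `Δⁿ × Δᵐ`, that is `Ωₙ ⊗ Ωₘ` with the Koszul sign rule; `ProdForm K (n + 1) m` is
`HatOmega K n m`. -/
abbrev ProdForm (n m : ℕ) : Type _ := grade K n ᵍ⊗[K] grade K m

variable (K) in
/-- The total differential `a ⊗ b ↦ da ⊗ b + (-1)^{|a|} a ⊗ db` of `Ωₙ ⊗ Ωₘ`. -/
def prodD (n m : ℕ) : ProdForm K n m →ₗ[K] ProdForm K n m :=
  (GradedTensorProduct.of K (grade K n) (grade K m)).toLinearMap ∘ₗ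
    (TensorProduct.map (d K n) LinearMap.id + TensorProduct.map (invol K n).toLinearMap (d K m)) ∘ₗ
      (GradedTensorProduct.of K (grade K n) (grade K m)).symm.toLinearMap

theorem prodD_tmul (a : Omega K n) (b : Omega K m) :
    prodD K n m (a ᵍ⊗ₜ[K] b) = d K n a ᵍ⊗ₜ[K] b + invol K n a ᵍ⊗ₜ[K] d K m b :=
  rfl

theorem invol_mem_grade {a : Omega K n} (ha : a ∈ grade K n p) : invol K n a ∈ grade K n p := by
  rw [invol_of_mem_grade ha]
  exact Submodule.smul_mem _ _ ha

variable (K) in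
/-- The sign involution of `Ωₙ ⊗ Ωₘ`, which is `(-1)^p` in total degree `p`. -/
def prodInvol (n m : ℕ) : ProdForm K n m →ₐ[K] ProdForm K n m :=
  gradedMap (invol K n) (invol K m) (fun _ _ => invol_mem_grade) fun _ _ => invol_mem_grade

theorem prodInvol_of_mem {z : ProdForm K n m} (hz : z ∈ totalGrade (grade K n) (grade K m) p) :
    prodInvol K n m z = (-1 : K) ^ p • z := by
  refine (Submodule.span_le (p := LinearMap.eqLocus (prodInvol K n m).toLinearMap
    ((-1 : K) ^ p • LinearMap.id)) |>.2 ?_ hz :)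
  rintro _ ⟨r, s, a, ha, b, hb, rfl, rfl⟩
  change prodInvol K n m (a ᵍ⊗ₜ[K] b) = (-1 : K) ^ (r + s) • a ᵍ⊗ₜ[K] b
  rw [prodInvol, gradedMap_tmul, invol_of_mem_grade ha, invol_of_mem_grade hb,
    GradedTensorProduct.tmul, TensorProduct.smul_tmul_smul, ← pow_add, map_smul]

theorem prodD_mul (y z : ProdForm K n m) :
    prodD K n m (y * z) = prodD K n m y * z + prodInvol K n m y * prodD K n m z := by
  induction y using gradedTensor_induction with
  | zero => simp
  | add y y' hy hy' => simp only [add_mul, map_add, hy, hy']; abel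
  | tmul i j a ha b hb =>
    induction z using gradedTensor_induction with
    | zero => simp
    | add z z' hz hz' => simp only [mul_add, map_add, hz, hz']; abel
    | tmul i' _ a' ha' b' _ =>
      rw [gradedTmul_mul_gradedTmul a hb ha' b', map_smul, prodD_tmul, prodD_tmul, prodD_tmul,
        prodInvol, gradedMap_tmul, add_mul, mul_add, gradedTmul_mul_gradedTmul _ hb ha',
        gradedTmul_mul_gradedTmul _ (d_mem_grade hb) ha',
        gradedTmul_mul_gradedTmul _ (invol_mem_grade hb) (d_mem_grade ha'),
        gradedTmul_mul_gradedTmul _ (invol_mem_grade hb) (invol_mem_grade ha'),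
        d_mul, d_mul, map_mul, invol_of_mem_grade ha, invol_of_mem_grade ha',
        invol_of_mem_grade hb]
      simp only [GradedTensorProduct.tmul, smul_mul_assoc, mul_smul_comm, TensorProduct.add_tmul,
        TensorProduct.tmul_add, ← TensorProduct.smul_tmul', TensorProduct.tmul_smul, map_add,
        map_smul, smul_add, smul_smul, pow_add, mul_add, add_mul, one_mul, mul_one]
      have sign_sq : (-1 : K) ^ j * (-1 : K) ^ j = 1 := by rw [← mul_pow]; simp
      match_scalars <;>
        first | ring1 | linear_combination -((-1) ^ (j * i') * (-1) ^ i) * sign_sq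

/-- The pull-back along the product of the affine maps given by `g` and `h`. -/
def prodPullback (g : Fin (n' + 1) → Fin (n + 1)) (h : Fin (m' + 1) → Fin (m + 1)) :
    ProdForm K n m →ₐ[K] ProdForm K n' m' :=
  gradedMap (pullback g) (pullback h) (fun _ _ => pullback_mem_grade g)
    fun _ _ => pullback_mem_grade h

theorem prodPullback_tmul (g : Fin (n' + 1) → Fin (n + 1)) (h : Fin (m' + 1) → Fin (m + 1))
    (a : Omega K n) (b : Omega K m) :
    prodPullback g h (a ᵍ⊗ₜ[K] b) = pullback g a ᵍ⊗ₜ[K] pullback h b :=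
  gradedMap_tmul ..

variable [CharZero K]

theorem hatPull_mem_totalGrade (f : Fin (n + 1) → Fin (m + 1)) {a : Omega K m}
    (ha : a ∈ grade K m p) : hatPull f a ∈ totalGrade (grade K (n + 1)) (grade K m) p := by
  refine algHom_mem_of_mem_grade (fun j => ?_) (fun j => ?_) ha
  · rw [hatPull_x]
    exact add_mem (gradedTmul_mem_totalGrade (x_mem 0) (x_mem j) rfl)
      (gradedTmul_mem_totalGrade (sum_mem fun i _ => x_mem _) SetLike.GradedOne.one_mem rfl)
  · rw [hatPull_dx]
    exact add_mem (add_mem (gradedTmul_mem_totalGrade (dx_mem 0) (x_mem j) rfl)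
      (gradedTmul_mem_totalGrade (x_mem 0) (dx_mem j) rfl))
      (gradedTmul_mem_totalGrade (sum_mem fun i _ => dx_mem _) SetLike.GradedOne.one_mem rfl)

theorem hatPull_comp_d (f : Fin (n + 1) → Fin (m + 1)) :
    (hatPull (K := K) f).toLinearMap ∘ₗ d K m =
      prodD K (n + 1) m ∘ₗ (hatPull f).toLinearMap := by
  have prodInvol_hatPull {p : ℕ} {a : Omega K m} (ha : a ∈ grade K m p) :=
    prodInvol_of_mem (hatPull_mem_totalGrade f ha)
  refine comp_d_eq_of_skewDerivation prodD_mul ?_ (fun j => ?_) (fun j => ?_)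
    (fun j => by simpa using prodInvol_hatPull (x_mem j))
    (fun j => by simpa using prodInvol_hatPull (dx_mem j))
  · change prodD K (n + 1) m (1 ᵍ⊗ₜ[K] 1) = 0
    simp [prodD_tmul, d_one, GradedTensorProduct.tmul]
  · simp only [hatPull_x, hatPull_dx, hatDX, map_add, prodD_tmul, map_sum, d_x, d_one, invol_x]
    simp
  · simp only [hatPull_dx, hatDX, map_add, prodD_tmul, map_sum, d_x, d_dx, d_one, invol_x, invol_dx]
    simp [GradedTensorProduct.tmul, TensorProduct.neg_tmul]

theorem sum_filter_cons_eq_zero {V : Type*} [AddCommMonoid V] (c : Fin n' → Fin n)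
    (u : Fin (n' + 1) → V) :
    ∑ k with (Fin.cons 0 (Fin.succ ∘ c) : Fin (n' + 1) → Fin (n + 1)) k = 0, u k = u 0 := by
  rw [Finset.sum_filter, Fin.sum_univ_succ]
  simp

theorem sum_filter_cons_eq_succ {V : Type*} [AddCommMonoid V] (c : Fin n' → Fin n)
    (u : Fin (n' + 1) → V) (i : Fin n) :
    ∑ k with (Fin.cons 0 (Fin.succ ∘ c) : Fin (n' + 1) → Fin (n + 1)) k = i.succ, u k =
      ∑ k with c k = i, u k.succ := by
  rw [Finset.sum_filter, Fin.sum_univ_succ, Finset.sum_filter]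
  simp [eq_comm]

theorem prodPullback_cons_comp_hatPull (f : Fin (n + 1) → Fin (m + 1))
    (c : Fin (n' + 1) → Fin (n + 1)) :
    (prodPullback (K := K) (Fin.cons 0 (Fin.succ ∘ c) : Fin (n' + 1 + 1) → Fin (n + 1 + 1))
      id).comp (hatPull f) = hatPull (f ∘ c) := by
  refine algHom_ext (fun j => ?_) fun j => ?_
  · simp only [AlgHom.comp_apply, hatPull_x, map_add, prodPullback_tmul, pullback_id,
      AlgHom.id_apply, map_sum, map_one, pullback_x, sum_filter_cons_eq_zero,
      sum_filter_cons_eq_succ, sum_filter_comp f c]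
  · simp only [AlgHom.comp_apply, hatPull_dx, hatDX, map_add, prodPullback_tmul, pullback_id,
      AlgHom.id_apply, map_sum, map_one, pullback_x, pullback_dx, sum_filter_cons_eq_zero,
      sum_filter_cons_eq_succ, sum_filter_comp f c]

theorem prodPullback_succ_comp_hatPull (f : Fin (n + 1) → Fin (m + 1)) :
    (prodPullback (K := K) Fin.succ id).comp (hatPull f) =
      (GradedTensorProduct.includeLeft (grade K n) (grade K m)).comp (pullback f) := by
  refine algHom_ext (fun j => ?_) fun j => ?_
  · simp [hatPull_x, prodPullback_tmul, pullback_id, pullback_x, Finset.filter_eq',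
      GradedTensorProduct.tmul, TensorProduct.sum_tmul]
  · simp [hatPull_dx, hatDX, prodPullback_tmul, pullback_id, pullback_dx, pullback_x,
      Finset.filter_eq', GradedTensorProduct.tmul, TensorProduct.sum_tmul]

theorem prodPullback_zero_comp_hatPull (f : Fin (0 + 1) → Fin (m + 1)) :
    (prodPullback (K := K) (fun _ : Fin (0 + 1) => (0 : Fin (0 + 1 + 1))) id).comp (hatPull f) =
      GradedTensorProduct.includeRight (grade K 0) (grade K m) := by
  have x_zero : x K (0 : Fin (0 + 1)) = 1 := by simpa [poly_X] using poly_sum (K := K) (n := 0)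
  have dx_zero : dx K (0 : Fin (0 + 1)) = 0 := by
    simpa [covec_single] using covec_sum (K := K) (n := 0)
  refine algHom_ext (fun j => ?_) fun j => ?_
  · simp [hatPull_x, prodPullback_tmul, pullback_id, pullback_x, x_zero, (Fin.succ_ne_zero _).symm,
      GradedTensorProduct.tmul]
  · simp [hatPull_dx, hatDX, prodPullback_tmul, pullback_id, pullback_dx, pullback_x, x_zero,
      dx_zero, (Fin.succ_ne_zero _).symm, GradedTensorProduct.tmul]

theorem hatPull_comp_pullback (h : Fin (n + 1) → Fin (m' + 1)) (g : Fin (m' + 1) → Fin (m + 1)) :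
    (hatPull h).comp (pullback (K := K) g) = (prodPullback id g).comp (hatPull (g ∘ h)) := by
  refine algHom_ext (fun j => ?_) fun j => ?_
  · simp only [AlgHom.comp_apply, hatPull_x, map_add, prodPullback_tmul, pullback_id,
      AlgHom.id_apply, map_sum, map_one, pullback_x, Finset.sum_add_distrib, tmul_sum_right,
      tmul_sum_left, sum_filter_comp g h]
  · simp only [AlgHom.comp_apply, hatPull_dx, hatDX, map_add, prodPullback_tmul, pullback_id,
      AlgHom.id_apply, map_sum, map_one, pullback_x, pullback_dx, Finset.sum_add_distrib,
      tmul_sum_right, tmul_sum_left, sum_filter_comp g h]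

end ProdForm

/-! ### Integration along the fibres -/

section FiberIntegral

variable {K : Type*} [Field K] [CharZero K] {n n' m m' p : ℕ}

variable (K) in
/-- The integral `∫ ⊗ Id` of a form on `Δⁿ × Δᵐ` over the first factor. -/
def fiberIntegral (n m : ℕ) : ProdForm K n m →ₗ[K] Omega K m :=
  (TensorProduct.lid K (Omega K m)).toLinearMap ∘ₗ (integral K n).rTensor (Omega K m) ∘ₗ
    (GradedTensorProduct.of K (grade K n) (grade K m)).symm.toLinearMap

theorem fiberIntegral_tmul (a : Omega K n) (b : Omega K m) :
    fiberIntegral K n m (a ᵍ⊗ₜ[K] b) = integral K n a • b :=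
  rfl

theorem manettiFace_apply (f : Fin (n + 1) → Fin (m + 1)) (a : Omega K m) :
    manettiFace K f a = fiberIntegral K (n + 1) m (hatPull f a) :=
  rfl

theorem fiberIntegral_prodD (z : ProdForm K (n + 1) m) :
    fiberIntegral K (n + 1) m (prodD K (n + 1) m z) =
      ∑ i : Fin (n + 1 + 1), (-1 : K) ^ (i : ℕ) •
        fiberIntegral K n m (prodPullback i.succAbove id z) +
      (-1 : K) ^ (n + 1) • d K m (fiberIntegral K (n + 1) m z) := by
  induction z using gradedTensor_induction with
  | zero => simp
  | add y z hy hz =>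
    simp only [map_add, hy, hz, smul_add, Finset.sum_add_distrib]
    abel
  | tmul _ _ a _ b _ =>
    have stokes := LinearMap.congr_fun (integral_comp_d (K := K) n) a
    simp only [LinearMap.comp_apply, LinearMap.sum_apply, LinearMap.smul_apply,
      AlgHom.toLinearMap_apply, smul_eq_mul] at stokes
    simp only [prodD_tmul, map_add, fiberIntegral_tmul, prodPullback_tmul, pullback_id,
      AlgHom.id_apply, integral_invol, stokes, map_smul, Finset.sum_smul, smul_smul]

theorem fiberIntegral_prodPullback_left_of_not_injective {g : Fin (n' + 1) → Fin (n + 1)}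
    (hg : ¬ Function.Injective g) (h : Fin (m' + 1) → Fin (m + 1)) (z : ProdForm K n m) :
    fiberIntegral K n' m' (prodPullback g h z) = 0 := by
  induction z using gradedTensor_induction with
  | zero => rw [map_zero, map_zero]
  | add y z hy hz => rw [map_add, map_add, hy, hz, add_zero]
  | tmul _ _ a _ b _ =>
    have integral_eq_zero := LinearMap.congr_fun (integral_pullback_of_not_injective hg) a
    rw [LinearMap.comp_apply, AlgHom.toLinearMap_apply, LinearMap.zero_apply] at integral_eq_zero
    rw [prodPullback_tmul, fiberIntegral_tmul, integral_eq_zero, zero_smul]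

theorem fiberIntegral_prodPullback_right (g : Fin (m' + 1) → Fin (m + 1)) (z : ProdForm K n m) :
    fiberIntegral K n m' (prodPullback id g z) = pullback g (fiberIntegral K n m z) := by
  induction z using gradedTensor_induction with
  | zero => simp only [map_zero]
  | add y z hy hz => simp only [map_add, hy, hz]
  | tmul _ _ a _ b _ =>
    rw [prodPullback_tmul, fiberIntegral_tmul, fiberIntegral_tmul, pullback_id, AlgHom.id_apply,
      map_smul]

theorem fiberIntegral_mem_grade {z : ProdForm K n m}
    (hz : z ∈ totalGrade (grade K n) (grade K m) (n + p)) :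
    fiberIntegral K n m z ∈ grade K m p := by
  refine (Submodule.span_le (p := (grade K m p).comap (fiberIntegral K n m))).2 ?_ hz
  rintro _ ⟨r, s, a, ha, b, hb, hrs, rfl⟩
  rw [SetLike.mem_coe, Submodule.mem_comap, fiberIntegral_tmul]
  by_cases hr : r = n
  · obtain rfl : s = p := by omega
    exact Submodule.smul_mem _ _ hb
  · rw [integral_of_ne hr ha, zero_smul]
    exact zero_mem _

theorem fiberIntegral_eq_zero_of_lt (hp : p < n) {z : ProdForm K n m}
    (hz : z ∈ totalGrade (grade K n) (grade K m) p) : fiberIntegral K n m z = 0 := by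
  refine (Submodule.span_le (p := LinearMap.ker (fiberIntegral K n m))).2 ?_ hz
  rintro _ ⟨r, s, a, ha, b, -, hrs, rfl⟩
  rw [SetLike.mem_coe, LinearMap.mem_ker, fiberIntegral_tmul, integral_of_ne (by omega) ha,
    zero_smul]

end FiberIntegral

/-! ### The operators `k_f` -/

section Face

variable {K : Type*} [Field K] [CharZero K] {n m m' p : ℕ}

theorem manettiFace_mem_grade (f : Fin (n + 1) → Fin (m + 1)) {a : Omega K m}
    (ha : a ∈ grade K m (n + 1 + p)) : manettiFace K f a ∈ grade K m p :=
  fiberIntegral_mem_grade (hatPull_mem_totalGrade f ha)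

theorem manettiFace_eq_zero_of_lt (hp : p < n + 1) (f : Fin (n + 1) → Fin (m + 1)) {a : Omega K m}
    (ha : a ∈ grade K m p) : manettiFace K f a = 0 :=
  fiberIntegral_eq_zero_of_lt hp (hatPull_mem_totalGrade f ha)

theorem manettiFace_pullback (h : Fin (n + 1) → Fin (m' + 1)) (g : Fin (m' + 1) → Fin (m + 1))
    (a : Omega K m) : manettiFace K h (pullback g a) = pullback g (manettiFace K (g ∘ h) a) := by
  rw [manettiFace_apply, manettiFace_apply, ← fiberIntegral_prodPullback_right]
  exact congrArg _ (DFunLike.congr_fun (hatPull_comp_pullback h g) a)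

-- If `f i = f j`, then `f̂` factors through the degenerate map of `Δ̂ⁿ` sending `tⱼ` to `tᵢ`.
theorem manettiFace_of_not_injective {f : Fin (n + 1) → Fin (m + 1)}
    (hf : ¬ Function.Injective f) : manettiFace K f = 0 := by
  obtain ⟨i, j, hij, hne⟩ := Function.not_injective_iff.1 hf
  have comp_update : f ∘ Function.update id j i = f := by
    rw [Function.comp_update, hij]
    exact Function.update_eq_self j f
  have not_injective : ¬ Function.Injective (Fin.cons 0 (Fin.succ ∘ Function.update id j i) :
      Fin (n + 1 + 1) → Fin (n + 1 + 1)) := fun h =>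
    hne (Fin.succ_injective _ (@h i.succ j.succ (by simp [Function.update_of_ne hne])))
  ext a
  rw [manettiFace_apply, ← comp_update, ← prodPullback_cons_comp_hatPull, AlgHom.comp_apply,
    fiberIntegral_prodPullback_left_of_not_injective not_injective, LinearMap.zero_apply]

theorem fiberIntegral_facet_zero (f : Fin (n + 1) → Fin (m + 1)) (a : Omega K m) :
    fiberIntegral K n m (prodPullback (Fin.succAbove 0) id (hatPull f a)) =
      integral K n (pullback f a) • 1 := by
  rw [Fin.succAbove_zero, ← AlgHom.comp_apply, prodPullback_succ_comp_hatPull]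
  rfl

theorem fiberIntegral_facet_succ (f : Fin (n + 1 + 1) → Fin (m + 1)) (i : Fin (n + 1 + 1))
    (a : Omega K m) :
    fiberIntegral K (n + 1) m (prodPullback i.succ.succAbove id (hatPull f a)) =
      manettiFace K (f ∘ i.succAbove) a := by
  have succAbove_succ : i.succ.succAbove = Fin.cons 0 (Fin.succ ∘ i.succAbove) := by
    ext k
    refine Fin.cases ?_ (fun k => ?_) k <;> simp
  rw [succAbove_succ, ← AlgHom.comp_apply, prodPullback_cons_comp_hatPull, manettiFace_apply]

theorem fiberIntegral_facet_one (f : Fin (0 + 1) → Fin (m + 1)) (a : Omega K m) :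
    fiberIntegral K 0 m (prodPullback (Fin.succAbove (1 : Fin (0 + 1 + 1))) id (hatPull f a)) =
      a := by
  have succAbove_one : Fin.succAbove (1 : Fin (0 + 1 + 1)) = fun _ : Fin (0 + 1) => 0 := by decide
  have integral_one : integral K 0 1 = 1 := by
    simpa using integral_monomial (K := K) (n := 0) (fun _ => 0) 0
  rw [succAbove_one, ← AlgHom.comp_apply, prodPullback_zero_comp_hatPull,
    GradedTensorProduct.includeRight_apply, fiberIntegral_tmul, integral_one, one_smul]

theorem manettiFace_d (f : Fin (n + 1) → Fin (m + 1)) (a : Omega K m) :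
    manettiFace K f (d K m a) =
      ∑ i : Fin (n + 1 + 1), (-1 : K) ^ (i : ℕ) •
        fiberIntegral K n m (prodPullback i.succAbove id (hatPull f a)) +
      (-1 : K) ^ (n + 1) • d K m (manettiFace K f a) := by
  rw [manettiFace_apply, manettiFace_apply, ← fiberIntegral_prodD]
  exact congrArg _ (LinearMap.congr_fun (hatPull_comp_d f) a)

theorem manettiFace_d_zero (f : Fin (0 + 1) → Fin (m + 1)) (a : Omega K m) :
    manettiFace K f (d K m a) =
      integral K 0 (pullback f a) • 1 - a - d K m (manettiFace K f a) := by
  rw [manettiFace_d, Fin.sum_univ_two, fiberIntegral_facet_zero, fiberIntegral_facet_one]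
  simp [sub_eq_add_neg]

theorem manettiFace_d_succ (f : Fin (n + 1 + 1) → Fin (m + 1)) (a : Omega K m) :
    manettiFace K f (d K m a) = integral K (n + 1) (pullback f a) • 1 -
      ∑ i : Fin (n + 1 + 1), (-1 : K) ^ (i : ℕ) • manettiFace K (f ∘ i.succAbove) a +
      (-1 : K) ^ n • d K m (manettiFace K f a) := by
  rw [manettiFace_d, Fin.sum_univ_succ, fiberIntegral_facet_zero]
  simp only [fiberIntegral_facet_succ, Fin.val_succ, pow_succ, Fin.val_zero, pow_zero, one_smul,
    mul_neg_one, neg_neg, neg_smul, Finset.sum_neg_distrib, sub_eq_add_neg]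

end Face

/-! ### Faces of order embeddings -/

section Faces

variable {α : Type*} {n : ℕ}

theorem range_eq_insert_removeNth (g : Fin (n + 1) → α) (i : Fin (n + 1)) :
    Set.range g = insert (g i) (Set.range (i.removeNth g)) := by
  conv_lhs => rw [← Fin.insertNth_self_removeNth i g]
  exact Fin.range_insertNth ..

variable [LinearOrder α]

theorem face_vertex_injective :
    Function.Injective fun z : (Fin (n + 1) ↪o α) × Fin (n + 1) =>
      (z.2.succAboveOrderEmb.trans z.1, z.1 z.2) := by
  rintro ⟨g, i⟩ ⟨g', i'⟩ h
  obtain ⟨hface, hvertex⟩ := Prod.mk.inj h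
  have hface' : i.removeNth g = i'.removeNth g' := congrArg DFunLike.coe hface
  obtain rfl : g = g' := by
    rw [← OrderEmbedding.range_inj, range_eq_insert_removeNth g i,
      range_eq_insert_removeNth g' i', hface', show g i = g' i' from hvertex]
  exact Prod.ext rfl (g.injective hvertex)

theorem exists_face_vertex_eq {f : Fin n ↪o α} {k : α} (hk : k ∉ Set.range f) :
    ∃ (g : Fin (n + 1) ↪o α) (i : Fin (n + 1)), i.succAboveOrderEmb.trans g = f ∧ g i = k := by
  have cons_injective : Function.Injective (Fin.cons k f : Fin (n + 1) → α) :=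
    Fin.cons_injective_iff.2 ⟨hk, f.injective⟩
  set s : Finset α := Finset.univ.image (Fin.cons k f : Fin (n + 1) → α)
  have hs : s.card = n + 1 := by
    rw [Finset.card_image_of_injective _ cons_injective, Finset.card_fin]
  set g := s.orderEmbOfFin hs
  have hg : Set.range g = insert k (Set.range f) := by
    rw [Finset.range_orderEmbOfFin, Finset.coe_image, Finset.coe_univ, Set.image_univ,
      Fin.range_cons]
  obtain ⟨i, hi⟩ : k ∈ Set.range g := hg ▸ Set.mem_insert _ _
  refine ⟨g, i, OrderEmbedding.range_inj.1 ?_, hi⟩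
  have hk' : k ∉ Set.range (i.removeNth g) := by
    rintro ⟨l, hl⟩
    exact Fin.succAbove_ne i l (g.injective (hl.trans hi.symm))
  rw [range_eq_insert_removeNth g i, hi] at hg
  calc Set.range (i.removeNth g) = insert k (Set.range (i.removeNth g)) \ {k} :=
        (Set.insert_sdiff_self_of_notMem hk').symm
    _ = Set.range f := by rw [hg, Set.insert_sdiff_self_of_notMem hk]

theorem sum_face_vertex [Fintype α] [Fintype (Fin n ↪o α)] [Fintype (Fin (n + 1) ↪o α)]
    {V : Type*} [AddCommMonoid V] {Φ : (Fin n → α) → α → V}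
    (hΦ : ∀ f k, k ∈ Set.range f → Φ f k = 0) :
    ∑ g : Fin (n + 1) ↪o α, ∑ i, Φ (i.removeNth g) (g i) = ∑ f : Fin n ↪o α, ∑ k, Φ f k := by
  rw [← Fintype.sum_prod_type', ← Fintype.sum_prod_type']
  refine Finset.sum_of_injOn _ face_vertex_injective.injOn (fun _ _ => by simp)
    (fun ⟨f, k⟩ _ not_mem => hΦ f k ?_) fun _ _ => rfl
  by_contra hk
  obtain ⟨g, i, hface, hvertex⟩ := exists_face_vertex_eq hk
  exact not_mem ⟨(g, i), by simp, Prod.ext hface hvertex⟩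

theorem sum_orderEmbedding {ι : Type*} [LinearOrder ι] [Fintype ι] [Fintype α]
    [Fintype (ι ↪o α)] {V : Type*} [AddCommMonoid V] (F : (ι → α) → V)
    [DecidablePred fun h : ι → α => StrictMono h] :
    ∑ h : ι ↪o α, F h = ∑ h : ι → α with StrictMono h, F h := by
  refine Finset.sum_bij (fun h _ => h) (fun h _ => ?_) (fun _ _ _ _ e => DFunLike.coe_injective e)
    (fun h hh => ?_) fun _ _ => rfl
  · exact Finset.mem_filter.2 ⟨Finset.mem_univ _, h.strictMono⟩
  · exact ⟨OrderEmbedding.ofStrictMono h (Finset.mem_filter.1 hh).2, Finset.mem_univ _, rfl⟩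

theorem sum_orderEmbedding_fiber {β ι : Type*} [LinearOrder β] [LinearOrder ι] [Fintype ι]
    [Fintype α] [Finite β] [Fintype (ι ↪o α)] [Fintype (ι ↪o β)] {V : Type*} [AddCommMonoid V]
    {g : α → β} (hg : Monotone g) {F : (ι → α) → V}
    (hF : ∀ h, ¬ Function.Injective (g ∘ h) → F h = 0) :
    ∑ f : ι ↪o β, ∑ h : ι → α with g ∘ h = f, F h = ∑ h : ι ↪o α, F h := by
  classical
  have := Fintype.ofFinite β
  rw [sum_orderEmbedding, sum_orderEmbedding fun f => ∑ h : ι → α with g ∘ h = f, F h,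
    Finset.sum_fiberwise_eq_sum_filter]
  refine Finset.sum_subset (fun h hh => ?_) fun h hh hgh => hF h fun inj => hgh ?_
  · simp only [Finset.mem_filter, Finset.mem_univ, true_and] at hh ⊢
    exact fun _ _ hab => hg.reflect_lt (hh hab)
  · simp only [Finset.mem_filter, Finset.mem_univ, true_and] at hh ⊢
    exact (hg.comp hh.monotone).strictMono_of_injective inj

theorem comp_eq_coe_iff {f g : Fin n ↪o α} {h : Fin n → Fin n} :
    g ∘ h = f ↔ h = id ∧ g = f := by
  refine ⟨fun hgh => ?_, by rintro ⟨rfl, rfl⟩; rfl⟩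
  have strictMono : StrictMono h := fun a b hab =>
    g.lt_iff_lt.1 (hgh ▸ f.strictMono hab : (g ∘ h) a < (g ∘ h) b)
  obtain rfl : h = id := (strictMono.range_inj strictMono_id).1 <|
    (Finite.surjective_of_injective strictMono.injective).range_eq.trans Set.range_id.symm
  exact ⟨rfl, DFunLike.coe_injective hgh⟩

theorem isEmpty_orderEmbedding {p : ℕ} (h : p < n) : IsEmpty (Fin n ↪o Fin p) :=
  ⟨fun f => h.not_ge (by simpa using Fintype.card_le_of_injective f f.injective)⟩

end Faces

/-! ### Whitney forms -/

section Whitney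

variable {K : Type*} [Field K] {n m p : ℕ}

variable (K m) in
/-- The function on the simplex given by the linear form with coefficients `u`; its differential
is `covec m u`. -/
def coord : (Fin (m + 1) → K) →ₗ[K] Omega K m :=
  (poly m).toLinearMap ∘ₗ Fintype.linearCombination K MvPolynomial.X

theorem coord_eq_sum (u : Fin (m + 1) → K) : coord K m u = ∑ i, u i • x K i := by
  simp [coord, Fintype.linearCombination_apply, poly_X]

theorem coord_single (i : Fin (m + 1)) : coord K m (Pi.single i 1) = x K i := by
  rw [coord, LinearMap.comp_apply, Fintype.linearCombination_apply_single, one_smul]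
  exact poly_X i

theorem coord_mul_wedge_mem_grade (u : Fin (m + 1) → K) (v : Fin p → Fin (m + 1) → K) :
    coord K m u * wedge K m p v ∈ grade K m p :=
  poly_mul_wedge_mem_grade _ v

theorem d_coord_mul_wedge (u : Fin (m + 1) → K) (v : Fin p → Fin (m + 1) → K) :
    d K m (coord K m u * wedge K m p v) = wedge K m (p + 1) (Fin.cons u v) := by
  have d_wedge : d K m (wedge K m p v) = 0 := by simpa using d_poly_mul_wedge (n := m) 1 v
  simp only [coord_eq_sum, wedge_cons, covec_eq_sum, Finset.sum_mul, map_sum, smul_mul_assoc,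
    map_smul, d_x_mul, d_wedge, mul_zero, add_zero]

theorem pullback_coord (g : Fin (n + 1) → Fin (m + 1)) (u : Fin (m + 1) → K) :
    pullback g (coord K m u) = coord K n (u ∘ g) := by
  simp only [coord_eq_sum, map_sum, map_smul, pullback_x, Finset.smul_sum, Function.comp_apply]
  rw [← Finset.sum_fiberwise (s := Finset.univ) (g := g)]
  refine Finset.sum_congr rfl fun j _ => Finset.sum_congr rfl fun i hi => ?_
  rw [(Finset.mem_filter.1 hi).2]

theorem neg_one_pow_zsmul {V : Type*} [AddCommGroup V] [Module K V] (k : ℕ) (v : V) :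
    (-1 : ℤ) ^ k • v = (-1 : K) ^ k • v := by
  rw [← Int.cast_smul_eq_zsmul K]
  push_cast
  rfl

theorem map_cons_removeNth {V W : Type*} [AddCommGroup V] [Module K V] [AddCommGroup W]
    [Module K W] (A : V [⋀^Fin (n + 1)]→ₗ[K] W) (v : Fin (n + 1) → V) (i : Fin (n + 1)) :
    A (Fin.cons (v i) (i.removeNth v)) = (-1 : K) ^ (i : ℕ) • A v := by
  have h := A.neg_one_pow_smul_map_insertNth i (v i) (i.removeNth v)
  rw [Fin.insertNth_self_removeNth, neg_one_pow_zsmul (K := K)] at h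
  exact h.symm

variable (K) in
/-- The alternating multilinear extension of the Whitney forms without their factor `n!`, from
tuples of vertices to tuples of linear forms. -/
def whitneyAlt (m n : ℕ) : (Fin (m + 1) → K) [⋀^Fin (n + 1)]→ₗ[K] Omega K m :=
  AlternatingMap.alternatizeUncurryFin
    { toFun := fun u => (LinearMap.mulLeft K (coord K m u)).compAlternatingMap (wedge K m n)
      map_add' := fun u u' => by ext v; simp [add_mul]
      map_smul' := fun c u => by ext v; simp }

theorem whitneyAlt_apply (v : Fin (n + 1) → Fin (m + 1) → K) :
    whitneyAlt K m n v =
      ∑ i : Fin (n + 1), (-1 : K) ^ (i : ℕ) • (coord K m (v i) * wedge K m n (i.removeNth v)) := by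
  simp only [whitneyAlt, AlternatingMap.alternatizeUncurryFin_apply, neg_one_pow_zsmul (K := K)]
  rfl

theorem whitney_eq_whitneyAlt (f : Fin (n + 1) → Fin (m + 1)) :
    whitney K f = (n.factorial : K) • whitneyAlt K m n fun i => Pi.single (f i) 1 := by
  simp only [whitney, whitneyAlt_apply, coord_single, wedge_eq_prod, Fin.removeNth_apply,
    covec_single]

theorem whitney_mem_grade (f : Fin (n + 1) → Fin (m + 1)) : whitney K f ∈ grade K m n := by
  rw [whitney_eq_whitneyAlt, whitneyAlt_apply]
  exact Submodule.smul_mem _ _ <| sum_mem fun i _ =>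
    Submodule.smul_mem _ _ (coord_mul_wedge_mem_grade _ _)

theorem whitney_of_not_injective {f : Fin (n + 1) → Fin (m + 1)}
    (hf : ¬ Function.Injective f) : whitney K f = 0 := by
  obtain ⟨i, j, hij, hne⟩ := Function.not_injective_iff.1 hf
  rw [whitney_eq_whitneyAlt, AlternatingMap.map_eq_zero_of_eq _ _ (by rw [hij]) hne, smul_zero]

theorem d_whitneyAlt (v : Fin (n + 1) → Fin (m + 1) → K) :
    d K m (whitneyAlt K m n v) = ((n + 1 : ℕ) : K) • wedge K m (n + 1) v := by
  have d_term (i : Fin (n + 1)) : d K m ((-1 : K) ^ (i : ℕ) •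
      (coord K m (v i) * wedge K m n (i.removeNth v))) = wedge K m (n + 1) v := by
    rw [map_smul, d_coord_mul_wedge, map_cons_removeNth, smul_smul, pow_mul_pow_eq_one _ (by simp),
      one_smul]
  rw [whitneyAlt_apply, map_sum, Finset.sum_congr rfl fun i _ => d_term i, Finset.sum_const,
    Finset.card_fin, Nat.cast_smul_eq_nsmul]

theorem whitneyAlt_cons (u : Fin (m + 1) → K) (v : Fin (n + 1) → Fin (m + 1) → K) :
    whitneyAlt K m (n + 1) (Fin.cons u v) =
      coord K m u * wedge K m (n + 1) v - covec m u * whitneyAlt K m n v := by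
  have coord_comm (w) : coord K m w * covec m u = covec m u * coord K m w := poly_commute _ _
  have removeNth_succ (i : Fin (n + 1)) :
      i.succ.removeNth (Fin.cons u v : Fin (n + 1 + 1) → Fin (m + 1) → K) =
        Fin.cons u (i.removeNth v) := Fin.cons_comp_succ_succAbove u v i
  rw [whitneyAlt_apply, Fin.sum_univ_succ, whitneyAlt_apply, Finset.mul_sum, sub_eq_add_neg,
    ← Finset.sum_neg_distrib]
  congr 1
  · simp
  · refine Finset.sum_congr rfl fun i _ => ?_
    rw [removeNth_succ, Fin.cons_succ, wedge_cons, ← mul_assoc, coord_comm, mul_assoc,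
      mul_smul_comm, Fin.val_succ, pow_succ, mul_neg_one, neg_smul]

theorem single_comp_cons (k : Fin (m + 1)) (f : Fin n → Fin (m + 1)) :
    (fun i => (Pi.single ((Fin.cons k f : Fin (n + 1) → Fin (m + 1)) i) 1 : Fin (m + 1) → K)) =
      Fin.cons (Pi.single k 1) fun i => Pi.single (f i) 1 :=
  funext (Fin.cases rfl fun _ => rfl)

theorem sum_x : ∑ i, x K i = (1 : Omega K m) :=
  (map_sum (poly m) _ _).symm.trans poly_sum

theorem d_whitney (f : Fin (n + 1) → Fin (m + 1)) :
    d K m (whitney K f) = ∑ k, whitney K (Fin.cons k f : Fin (n + 1 + 1) → Fin (m + 1)) := by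
  simp only [whitney_eq_whitneyAlt, single_comp_cons, whitneyAlt_cons, coord_single, map_smul,
    d_whitneyAlt]
  rw [← Finset.smul_sum, Finset.sum_sub_distrib, ← Finset.sum_mul, ← Finset.sum_mul, sum_x,
    covec_sum, one_mul, zero_mul, sub_zero, smul_smul, Nat.factorial_succ, Nat.cast_mul, mul_comm]

theorem whitney_cons_removeNth (g : Fin (n + 1 + 1) → Fin (m + 1)) (i : Fin (n + 1 + 1)) :
    whitney K (Fin.cons (g i) (i.removeNth g) : Fin (n + 1 + 1) → Fin (m + 1)) =
      (-1 : K) ^ (i : ℕ) • whitney K g := by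
  rw [whitney_eq_whitneyAlt, whitney_eq_whitneyAlt, single_comp_cons, smul_comm,
    ← map_cons_removeNth]
  rfl

theorem sum_d_whitney_mul (Φ : (Fin (n + 1) → Fin (m + 1)) → Omega K m) :
    ∑ f : Fin (n + 1) ↪o Fin (m + 1), d K m (whitney K f) * Φ f =
      ∑ g : Fin (n + 1 + 1) ↪o Fin (m + 1), ∑ i : Fin (n + 1 + 1),
        (-1 : K) ^ (i : ℕ) • (whitney K g * Φ (g ∘ i.succAbove)) := by
  have cons_of_mem_range (f : Fin (n + 1) → Fin (m + 1)) (k) (hk : k ∈ Set.range f) :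
      whitney K (Fin.cons k f : Fin (n + 1 + 1) → Fin (m + 1)) * Φ f = 0 := by
    rw [whitney_of_not_injective fun h => (Fin.cons_injective_iff.1 h).1 hk, zero_mul]
  simp only [d_whitney, Finset.sum_mul, ← sum_face_vertex cons_of_mem_range,
    whitney_cons_removeNth, smul_mul_assoc]
  rfl

theorem pullback_whitneyAlt (g : Fin (p + 1) → Fin (m + 1)) (v : Fin (n + 1) → Fin (m + 1) → K) :
    pullback g (whitneyAlt K m n v) = whitneyAlt K p n fun i => v i ∘ g := by
  simp only [whitneyAlt_apply, map_sum, map_smul, map_mul, pullback_coord, pullback_wedge]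
  rfl

theorem pullback_whitney (g : Fin (p + 1) → Fin (m + 1)) (f : Fin (n + 1) → Fin (m + 1)) :
    pullback g (whitney K f) = ∑ h : Fin (n + 1) → Fin (p + 1) with g ∘ h = f, whitney K h := by
  have single_comp (j : Fin (m + 1)) : (Pi.single j 1 : Fin (m + 1) → K) ∘ g =
      ∑ i with g i = j, Pi.single i 1 := by
    ext i
    simp [Finset.sum_apply, Pi.single_apply]
  simp only [whitney_eq_whitneyAlt, map_smul, pullback_whitneyAlt, single_comp]
  rw [← Finset.smul_sum, ← AlternatingMap.coe_multilinearMap, MultilinearMap.map_sum_finset]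
  refine congrArg _ (Finset.sum_congr ?_ fun _ _ => rfl)
  ext h
  simp [Fintype.mem_piFinset, funext_iff]

theorem sum_pullback_whitney_mul (g : Fin (p + 1) →o Fin (m + 1))
    {Φ : (Fin (n + 1) → Fin (m + 1)) → Omega K p}
    (hΦ : ∀ f, ¬ Function.Injective f → Φ f = 0) :
    ∑ f : Fin (n + 1) ↪o Fin (m + 1), pullback g (whitney K f) * Φ f =
      ∑ h : Fin (n + 1) ↪o Fin (p + 1), whitney K h * Φ (g ∘ h) := by
  rw [← sum_orderEmbedding_fiber g.monotone (F := fun h => whitney K h * Φ (g ∘ h))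
    fun h hh => by rw [hΦ _ hh, mul_zero]]
  refine Finset.sum_congr rfl fun f _ => ?_
  rw [pullback_whitney, Finset.sum_mul]
  refine Finset.sum_congr rfl fun h hh => ?_
  rw [(Finset.mem_filter.1 hh).2]

theorem whitney_mem_whitneySpace {f : Fin (n + 1) → Fin (m + 1)} (hf : Monotone f) :
    whitney K f ∈ whitneySpace K m :=
  Submodule.subset_span ⟨n, ⟨f, hf⟩, rfl⟩

theorem whitneySpace_le {S : Submodule K (Omega K m)}
    (h : ∀ n (f : Fin (n + 1) ↪o Fin (m + 1)), whitney K f ∈ S) : whitneySpace K m ≤ S := by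
  refine Submodule.span_le.2 ?_
  rintro _ ⟨n, f, rfl⟩
  by_cases hf : Function.Injective f
  · exact h n (OrderEmbedding.ofStrictMono f (f.monotone.strictMono_of_injective hf))
  · rw [whitney_of_not_injective hf]
    exact zero_mem S

theorem pullback_mem_whitneySpace (g : Fin (p + 1) →o Fin (m + 1)) {a : Omega K m}
    (ha : a ∈ whitneySpace K m) : pullback g a ∈ whitneySpace K p := by
  suffices h : whitneySpace K m ≤ (whitneySpace K p).comap (pullback g).toLinearMap from h ha
  refine whitneySpace_le fun n f => ?_
  rw [Submodule.mem_comap, AlgHom.toLinearMap_apply, pullback_whitney]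
  refine sum_mem fun h hh => whitney_mem_whitneySpace (StrictMono.monotone fun a b hab => ?_)
  have hgh : g ∘ h = f := (Finset.mem_filter.1 hh).2
  exact g.monotone.reflect_lt (hgh ▸ f.strictMono hab : (g ∘ h) a < (g ∘ h) b)

theorem dirichletMoment_X {σ : Type*} [Fintype σ] (r : ℕ) (i : σ) :
    dirichletMoment K σ r (MvPolynomial.X i) = 1 / ((r + 1).factorial : K) := by
  classical
  rw [MvPolynomial.X, dirichletMoment_monomial, Finset.prod_eq_one, Nat.cast_one]
  · simp [Finsupp.single_apply, add_comm]
  · intro j _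
    by_cases h : i = j <;> simp [h]

theorem simplexDet_single_succAbove (i : Fin (n + 1)) :
    simplexDet (fun j => Pi.single (i.succAbove j) (1 : K)) = (-1) ^ (i : ℕ) := by
  rw [← det_cons_single, simplexDet, Finset.univ_sum_single fun _ => (1 : K)]
  rfl

variable [CharZero K]

theorem integral_whitney_id (n : ℕ) :
    integral K n (whitney K (id : Fin (n + 1) → Fin (n + 1))) = 1 := by
  have integral_term (i : Fin (n + 1)) : integral K n ((-1 : K) ^ (i : ℕ) •
      (coord K n (Pi.single i 1) * wedge K n n fun j => Pi.single (i.succAbove j) 1)) =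
      1 / ((n + 1).factorial : K) := by
    rw [coord_single, ← poly_X, map_smul, integral_poly_mul_wedge, dirichletMoment_X,
      simplexDet_single_succAbove, smul_eq_mul, mul_left_comm, pow_mul_pow_eq_one _ (by simp),
      mul_one]
  have factorial_ne_zero : ((n + 1).factorial : K) ≠ 0 :=
    Nat.cast_ne_zero.2 (n + 1).factorial_ne_zero
  rw [whitney_eq_whitneyAlt, map_smul, whitneyAlt_apply, map_sum]
  calc (n.factorial : K) • ∑ i : Fin (n + 1), integral K n ((-1 : K) ^ (i : ℕ) •
        (coord K n (Pi.single i 1) * wedge K n n fun j => Pi.single (i.succAbove j) 1))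
    _ = (n.factorial : K) • (n + 1) • (1 / ((n + 1).factorial : K)) := by
        simp only [integral_term, Finset.sum_const, Finset.card_fin]
    _ = 1 := by
        rw [nsmul_eq_mul, smul_eq_mul, ← mul_assoc, mul_comm (n.factorial : K), ← Nat.cast_mul,
          ← Nat.factorial_succ, mul_one_div_cancel factorial_ne_zero]

theorem integral_pullback_whitney (f g : Fin (n + 1) ↪o Fin (m + 1)) :
    integral K n (pullback g (whitney K f)) = if g = f then 1 else 0 := by
  simp only [pullback_whitney, comp_eq_coe_iff]
  split_ifs with hgf <;> simp [hgf, Finset.filter_eq', integral_whitney_id]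

end Whitney

/-! ### The homotopy and the projector -/

section Contraction

variable {K : Type*} [Field K] {n m p : ℕ}

theorem sum_whitney_vertex (m : ℕ) :
    ∑ f : Fin (0 + 1) ↪o Fin (m + 1), whitney K f = (1 : Omega K m) := by
  let _ : Unique (Fin (0 + 1)) := inferInstanceAs (Unique (Fin 1))
  have whitney_vertex (f : Fin (0 + 1) → Fin (m + 1)) : whitney K f = x K (f 0) := by
    simp [whitney]
  simp only [whitney_vertex]
  rw [sum_orderEmbedding fun f : Fin (0 + 1) → Fin (m + 1) => x K (f 0),
    Finset.filter_true_of_mem fun f _ => Subsingleton.strictMono f, ← sum_x]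
  exact (Equiv.funUnique (Fin (0 + 1)) (Fin (m + 1))).sum_comp fun j => x K j

theorem sum_range_orderEmbedding {V : Type*} [AddCommMonoid V] {N : ℕ} (hN : m + 1 ≤ N)
    (u : ∀ n, (Fin (n + 1) ↪o Fin (m + 1)) → V) :
    ∑ n ∈ Finset.range (m + 1), ∑ f, u n f = ∑ n ∈ Finset.range N, ∑ f, u n f := by
  refine Finset.sum_subset (Finset.range_mono hN) fun n _ hn => ?_
  have := isEmpty_orderEmbedding (n := n + 1) (p := m + 1) (by simpa using hn)
  exact Fintype.sum_empty _

theorem d_whitney_mul (f : Fin (n + 1) → Fin (m + 1)) (b : Omega K m) :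
    d K m (whitney K f * b) = d K m (whitney K f) * b + (-1 : K) ^ n • (whitney K f * d K m b) := by
  rw [d_mul, invol_of_mem_grade (whitney_mem_grade f), smul_mul_assoc]

variable [CharZero K]

theorem manetti_apply (a : Omega K m) :
    manetti K m a = ∑ n ∈ Finset.range (m + 1), ∑ f : Fin (n + 1) ↪o Fin (m + 1),
      whitney K f * manettiFace K f a := by
  simp [manetti, LinearMap.sum_apply]

theorem whitneyProj_apply (a : Omega K m) :
    whitneyProj K m a = ∑ n ∈ Finset.range (m + 1), ∑ f : Fin (n + 1) ↪o Fin (m + 1),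
      integral K n (pullback f a) • whitney K f := by
  simp [whitneyProj, LinearMap.sum_apply]

theorem sum_homotopy_zero (a : Omega K m) :
    ∑ f : Fin (0 + 1) ↪o Fin (m + 1), (whitney K f * manettiFace K f (d K m a) +
        d K m (whitney K f * manettiFace K f a)) =
      ∑ f : Fin (0 + 1) ↪o Fin (m + 1), integral K 0 (pullback f a) • whitney K f - a +
      ∑ f : Fin (0 + 1) ↪o Fin (m + 1), d K m (whitney K f) * manettiFace K f a := by
  have ha : ∑ f : Fin (0 + 1) ↪o Fin (m + 1), whitney K f * a = a := by
    rw [← Finset.sum_mul, sum_whitney_vertex, one_mul]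
  calc _ = ∑ f : Fin (0 + 1) ↪o Fin (m + 1), (integral K 0 (pullback f a) • whitney K f -
          whitney K f * a + d K m (whitney K f) * manettiFace K f a) :=
        Finset.sum_congr rfl fun f _ => by
          rw [manettiFace_d_zero, d_whitney_mul, mul_sub, mul_sub, mul_smul_comm, mul_one,
            pow_zero, one_smul]
          abel
    _ = _ := by rw [Finset.sum_add_distrib, Finset.sum_sub_distrib, ha]

theorem sum_homotopy_succ (a : Omega K m) :
    ∑ f : Fin (n + 1 + 1) ↪o Fin (m + 1), (whitney K f * manettiFace K f (d K m a) +
        d K m (whitney K f * manettiFace K f a)) =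
      ∑ f : Fin (n + 1 + 1) ↪o Fin (m + 1), integral K (n + 1) (pullback f a) • whitney K f -
      ∑ f : Fin (n + 1) ↪o Fin (m + 1), d K m (whitney K f) * manettiFace K f a +
      ∑ f : Fin (n + 1 + 1) ↪o Fin (m + 1), d K m (whitney K f) * manettiFace K f a := by
  rw [sum_d_whitney_mul fun f => manettiFace K f a, ← Finset.sum_sub_distrib,
    ← Finset.sum_add_distrib]
  refine Finset.sum_congr rfl fun f _ => ?_
  rw [manettiFace_d_succ, d_whitney_mul, mul_add, mul_sub, mul_smul_comm, mul_one, Finset.mul_sum,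
    mul_smul_comm, pow_succ, mul_neg_one, neg_smul]
  simp only [mul_smul_comm]
  abel

theorem sum_homotopy (a : Omega K m) (N : ℕ) :
    ∑ n ∈ Finset.range (N + 1), ∑ f : Fin (n + 1) ↪o Fin (m + 1),
        (whitney K f * manettiFace K f (d K m a) + d K m (whitney K f * manettiFace K f a)) =
      ∑ n ∈ Finset.range (N + 1), ∑ f : Fin (n + 1) ↪o Fin (m + 1),
        integral K n (pullback f a) • whitney K f - a +
      ∑ f : Fin (N + 1) ↪o Fin (m + 1), d K m (whitney K f) * manettiFace K f a := by
  induction N with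
  | zero => rw [Finset.sum_range_one, Finset.sum_range_one, sum_homotopy_zero]
  | succ N ih =>
    rw [Finset.sum_range_succ, ih, sum_homotopy_succ, Finset.sum_range_succ _ (N + 1)]
    abel

theorem manetti_comp_d_add_d_comp_manetti (m : ℕ) :
    manetti K m ∘ₗ d K m + d K m ∘ₗ manetti K m = whitneyProj K m - LinearMap.id := by
  ext a
  have top_term :
      ∑ f : Fin (m + 1) ↪o Fin (m + 1), d K m (whitney K f) * manettiFace K f a = 0 := by
    have := isEmpty_orderEmbedding (Nat.lt_succ_self (m + 1))
    rw [sum_d_whitney_mul fun f => manettiFace K f a]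
    exact Fintype.sum_empty _
  have homotopy := sum_homotopy a m
  rw [top_term, add_zero] at homotopy
  simp only [LinearMap.add_apply, LinearMap.comp_apply, LinearMap.sub_apply, LinearMap.id_apply,
    manetti_apply, whitneyProj_apply, ← homotopy, map_sum, Finset.sum_add_distrib]

theorem manetti_comp_pullback (g : Fin (p + 1) →o Fin (m + 1)) :
    manetti K p ∘ₗ (pullback (K := K) g).toLinearMap =
      (pullback (K := K) g).toLinearMap ∘ₗ manetti K m := by
  ext a
  simp only [LinearMap.comp_apply, AlgHom.toLinearMap_apply]
  rw [manetti_apply, manetti_apply, sum_range_orderEmbedding (N := p + m + 1) (by omega),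
    sum_range_orderEmbedding (N := p + m + 1) (by omega), map_sum]
  refine Finset.sum_congr rfl fun n _ => ?_
  simp only [map_sum, map_mul, manettiFace_pullback]
  refine (sum_pullback_whitney_mul g
    (Φ := fun f => pullback (K := K) g (manettiFace K f a)) fun f hf => ?_).symm
  rw [manettiFace_of_not_injective hf, LinearMap.zero_apply, map_zero]

theorem whitneyProj_mem_whitneySpace (a : Omega K m) :
    whitneyProj K m a ∈ whitneySpace K m := by
  rw [whitneyProj_apply]
  exact sum_mem fun n _ => sum_mem fun f _ =>
    Submodule.smul_mem _ _ (whitney_mem_whitneySpace f.monotone)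

theorem whitneyProj_whitney (f : Fin (n + 1) ↪o Fin (m + 1)) :
    whitneyProj K m (whitney K f) = whitney K f := by
  have hn : n < m + 1 := by
    by_contra h
    exact (isEmpty_orderEmbedding (by omega)).false f
  rw [whitneyProj_apply, Finset.sum_eq_single_of_mem n (Finset.mem_range.2 hn)]
  · simp [integral_pullback_whitney]
  · refine fun k _ hk => Finset.sum_eq_zero fun g _ => ?_
    rw [integral_of_ne hk.symm (pullback_mem_grade _ (whitney_mem_grade _)), zero_smul]

theorem whitneyProj_of_mem {a : Omega K m} (ha : a ∈ whitneySpace K m) :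
    whitneyProj K m a = a :=
  (whitneySpace_le (S := LinearMap.eqLocus (whitneyProj K m) LinearMap.id)
    (fun _ f => whitneyProj_whitney f) ha :)

theorem isProj_whitneyProj (m : ℕ) : LinearMap.IsProj (whitneySpace K m) (whitneyProj K m) :=
  ⟨whitneyProj_mem_whitneySpace, fun _ => whitneyProj_of_mem⟩

theorem d_mem_whitneySpace {a : Omega K m} (ha : a ∈ whitneySpace K m) :
    d K m a ∈ whitneySpace K m :=
  map_mem_of_isProj (isProj_whitneyProj m)
    (comp_comm_of_homotopy (d_comp_d m) (manetti_comp_d_add_d_comp_manetti m)) ha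

theorem whitneyProj_mem_grade {a : Omega K m} (ha : a ∈ grade K m p) :
    whitneyProj K m a ∈ grade K m p := by
  rw [whitneyProj_apply]
  refine sum_mem fun n _ => sum_mem fun f _ => ?_
  by_cases hp : p = n
  · subst hp
    exact Submodule.smul_mem _ _ (whitney_mem_grade _)
  · rw [integral_of_ne hp (pullback_mem_grade _ ha), zero_smul]
    exact zero_mem _

theorem manetti_mem_grade {a : Omega K m} (ha : a ∈ grade K m (p + 1)) :
    manetti K m a ∈ grade K m p := by
  rw [manetti_apply]
  refine sum_mem fun n _ => sum_mem fun f _ => ?_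
  rcases lt_or_ge p n with hpn | hnp
  · rw [manettiFace_eq_zero_of_lt (by omega) f ha, mul_zero]
    exact zero_mem _
  · obtain ⟨k, rfl⟩ := Nat.exists_eq_add_of_le hnp
    rw [add_right_comm] at ha
    exact mul_mem_grade (whitney_mem_grade _) (manettiFace_mem_grade f ha) rfl

theorem manetti_of_mem_grade_zero {a : Omega K m} (ha : a ∈ grade K m 0) :
    manetti K m a = 0 := by
  rw [manetti_apply]
  refine Finset.sum_eq_zero fun n _ => Finset.sum_eq_zero fun f _ => ?_
  rw [manettiFace_eq_zero_of_lt n.succ_pos f ha, mul_zero]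

end Contraction

end PolyForm

end

theorem theorem3p2 (K : Type*) [Field K] [CharZero K] :
    (∀ m : ℕ, LinearMap.IsProj (PolyForm.whitneySpace K m) (PolyForm.whitneyProj K m)) ∧
    (∀ m : ℕ, PolyForm.manetti K m ∘ₗ PolyForm.d K m + PolyForm.d K m ∘ₗ PolyForm.manetti K m =
      PolyForm.whitneyProj K m - LinearMap.id) ∧
    (∀ (p m : ℕ) (g : Fin (p + 1) →o Fin (m + 1)),
      PolyForm.manetti K p ∘ₗ (PolyForm.pullback (K := K) g).toLinearMap =
        (PolyForm.pullback (K := K) g).toLinearMap ∘ₗ PolyForm.manetti K m) ∧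
    ∃ (hd : ∀ m : ℕ, ∀ η ∈ PolyForm.whitneySpace K m, PolyForm.d K m η ∈ PolyForm.whitneySpace K m)
      (hg : ∀ {p m : ℕ} (g : Fin (p + 1) →o Fin (m + 1)), ∀ η ∈ PolyForm.whitneySpace K m,
        (PolyForm.pullback (K := K) g).toLinearMap η ∈ PolyForm.whitneySpace K p)
      (hπ : ∀ m : ℕ, ∀ η : PolyForm.Omega K m, PolyForm.whitneyProj K m η ∈ PolyForm.whitneySpace K m),
      PolyForm.IsSimplicialContraction
        (M := fun m => PolyForm.whitneySpace K m) (N := fun m => PolyForm.Omega K m)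
        (fun m p => (PolyForm.grade K m p).comap (PolyForm.whitneySpace K m).subtype)
        (fun m => (PolyForm.d K m).restrict (hd m))
        (fun g => (PolyForm.pullback (K := K) g).toLinearMap.restrict (hg g))
        (fun m => PolyForm.grade K m)
        (fun m => PolyForm.d K m)
        (fun g => (PolyForm.pullback (K := K) g).toLinearMap)
        (fun m => (PolyForm.whitneySpace K m).subtype)
        (fun m => PolyForm.manetti K m)
        (fun m => (PolyForm.whitneyProj K m).codRestrict (PolyForm.whitneySpace K m) (hπ m)) := by
  refine ⟨PolyForm.isProj_whitneyProj, PolyForm.manetti_comp_d_add_d_comp_manetti,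
    fun p m g => PolyForm.manetti_comp_pullback g, fun m η => PolyForm.d_mem_whitneySpace,
    fun g η => PolyForm.pullback_mem_whitneySpace g,
    fun m => PolyForm.whitneyProj_mem_whitneySpace, ?_⟩
  exact
    { isContraction := fun m => PolyForm.isContraction_of_isProj (PolyForm.isDG_grade m)
        (PolyForm.isProj_whitneyProj m) (fun p η => PolyForm.whitneyProj_mem_grade)
        (fun p η => PolyForm.manetti_mem_grade)
        (fun η => PolyForm.manetti_of_mem_grade_zero)
        (PolyForm.manetti_comp_d_add_d_comp_manetti m) fun η => PolyForm.d_mem_whitneySpace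
      map_id := fun m => congrArg AlgHom.toLinearMap PolyForm.pullback_id
      map_comp := fun g f => congrArg AlgHom.toLinearMap (PolyForm.pullback_comp g f)
      isDGHom_map := fun g => ⟨fun p η => PolyForm.pullback_mem_grade g, PolyForm.pullback_comp_d g⟩
      map_h := fun g => (PolyForm.manetti_comp_pullback g).symm
      map_hat := fun g => LinearMap.ext fun η => Subtype.ext
        (PolyForm.whitneyProj_of_mem (PolyForm.pullback_mem_whitneySpace g η.2)).symm }
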